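/- Let $A\in\mathbb R^{n\times n}$ and $B=[b_1,\dots,b_m]\in\mathbb R^{n\times m}$ with $n\ge 1$, and suppose that the system $x(k+1)=Ax(k)+Bu(k)$ is controllable, i.e. $[B\;AB\;\cdots\;A^{n-1}B]$ has rank $n$. Let $t\ge n$ be an integer and let $d>1$ be a real number such that $\kappa:=dt$ is an integer. Put $C=[B\;AB\;\cdots\;A^{t-1}B]$ and $W(t)=CC^\top=\sum_{i=0}^{t-1}A^iBB^\top (A^i)^\top$. A weighted actuator schedule is a family of scalings $s_i(k)\ge 0$ ($1\le i\le m$, $0\le k\le t-1$). Its active sets are $\sigma_k=\{i: s_i(k)>0\}$, and its Gramian is $$W_s(t)=\sum_{k=0}^{t-1}\sum_{j\in\sigma_k}s_j(k)^2\,(A^{t-k-1}b_j)(A^{t-k-1}b_j)^\top .$$ **DualSet\*.** The input consists of $V=[v_1,\dots,v_N]\in\mathbb R^{n\times N}$, $U=[u_1,\dots,u_N]\in\mathbb R^{\ell\times N}$ and an integer $\kappa>n$. For a symmetric matrix $M$ with eigenvalues $\lambda_i(M)$ (with multiplicity), put $\underline\phi(\mu,M)=\sum_i\frac1{\lambda_i(M)-\mu}$,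 $\overline\phi(\mu,M)=\sum_i\frac1{\mu-\lambda_i(M)}$ and $$\mathfrak L(v,\delta,M,\mu)=\frac{v^\top(M-(\mu+\delta)I)^{-2}v}{\underline\phi(\mu+\delta,M)-\underline\phi(\mu,M)}-v^\top(M-(\mu+\delta)I)^{-1}v,$$ $$\mathfrak U(u,\delta,M,\mu)=\frac{u^\top((\mu+\delta)I-M)^{-2}u}{\overline\phi(\mu,M)-\overline\phi(\mu+\delta,M)}+u^\top((\mu+\delta)I-M)^{-1}u.$$ Set $\overline\delta=\frac{1+\sqrt{\ell/\kappa}}{1-\sqrt{n/\kappa}}$, and start with $c(0)=0$, $\underline M=0\in\mathbb R^{n\times n}$, $\overline M=0\in\mathbb R^{\ell\times\ell}$. For $\tau=0,\dots,\kappa-1$, choose an index $j$ that maximizes $$\mathfrak L\bigl(v_j,1,\underline M,\tau-\sqrt{\kappa n}\bigr)-\mathfrak U\bigl(u_j,\overline\delta,\overline M,\overline\delta(\tau+\sqrt{\kappa\ell})\bigr),$$ let $\Delta=2/(\mathfrak U+\mathfrak L)$ at this $j$, and update $c(\tau+1)=c(\tau)+\Delta e_j$, $\underline M\leftarrow\underline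 M+\Delta v_jv_j^\top$, $\overline M\leftarrow\overline M+\Delta u_ju_j^\top$. Return $c=\kappa^{-1}\bigl(1-\sqrt{n/\kappa}\bigr)c(\kappa)$. **Scheduling algorithm.** Compute $C$ and $V=(CC^\top)^{-1/2}C$. Run DualSet\* on $V$, $U=V$ and $\kappa=dt$; write $c_{k,i}$ for the weight of the column of $V$ that comes from $A^kb_i$. Return $s_i(k)=\sqrt{c_{t-1-k,\,i}\,/\,(1+\frac{n}{dt})}$. **Theorem.** (a) However ties between maximizing indices are broken, the schedule $s$ returned by the algorithm satisfies $\frac1t\sum_{k=0}^{t-1}\mathrm{card}(\sigma_k)\le d$ and $$(1-\epsilon)\,W(t)\preceq W_s(t)\preceq(1+\epsilon)\,W(t),\qquad \epsilon=\frac{2}{\sqrt{dt/n}+\sqrt{n/(dt)}}\in(0,1).$$ (b) The algorithm has a deterministic implementation (ties are broken by the smallest index, and matrices are inverted by Gauss–Jordan elimination) that returns such a schedule within $O\bigl(dm(tn)^2\bigr)$ operations. Here an operation is an exact real addition, subtraction, multiplication, division, square root, comparison or conversion of an integer, and the one evaluation of $(CC^\top)^{-1/2}$ is charged $c_0n^3$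 operations for an arbitrary constant $c_0$. The implied constant depends only on $c_0$, not on $n,m,t,d,A,B$. -/

import Mathlib

open Matrix

namespace ActuatorScheduling

/-! ## Linear systems, Gramians and weighted actuator schedules -/

section Systems

variable {n m : ℕ}

/-- The vector `A ^ k b_i`, where `b_i` is the `i`-th column of `B`. -/
def reachVec (A : Matrix (Fin n) (Fin n) ℝ) (B : Matrix (Fin n) (Fin m) ℝ) (k : ℕ) (i : Fin m) :
    Fin n → ℝ :=
  fun r => (A ^ k * B) r i

/-- The controllability matrix `[B, AB, …, A^(t-1) B]`. Its columns are indexed by pairs `(k, i)`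
in lexicographic order: the column `(k, i)` is `A ^ k b_i`, the `i`-th column of block `k`. -/
def ctrbMatrix (A : Matrix (Fin n) (Fin n) ℝ) (B : Matrix (Fin n) (Fin m) ℝ) (t : ℕ) :
    Matrix (Fin n) (Fin t × Fin m) ℝ :=
  Matrix.of fun r q => reachVec A B q.1 q.2 r

/-- Controllability (Kalman): `[B, AB, …, A^(n-1) B]` has full row rank. -/
def IsControllable (A : Matrix (Fin n) (Fin n) ℝ) (B : Matrix (Fin n) (Fin m) ℝ) : Prop :=
  (ctrbMatrix A B n).rank = n

/-- The controllability Gramian `W(t) = ∑_{i < t} A^i B Bᵀ (A^i)ᵀ`. -/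
def gramian (A : Matrix (Fin n) (Fin n) ℝ) (B : Matrix (Fin n) (Fin m) ℝ) (t : ℕ) :
    Matrix (Fin n) (Fin n) ℝ :=
  ∑ i ∈ Finset.range t, A ^ i * B * Bᵀ * (A ^ i)ᵀ

/-- The set `σ_k = {i | s_i(k) > 0}` of actuators that are active at time `k`. -/
noncomputable def activeSet {t : ℕ} (s : Fin m → Fin t → ℝ) (k : Fin t) : Finset (Fin m) :=
  Finset.univ.filter fun i => 0 < s i k

/-- The Gramian at time `t` of `x(k+1) = A x(k) + ∑_{i ∈ σ_k} s_i(k) b_i u_i(k)`, that is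
`W_s(t) = ∑_{k < t} ∑_{j ∈ σ_k} s_j(k)² (A^(t-k-1) b_j) (A^(t-k-1) b_j)ᵀ`. -/
noncomputable def scheduleGramian (A : Matrix (Fin n) (Fin n) ℝ) (B : Matrix (Fin n) (Fin m) ℝ)
    {t : ℕ} (s : Fin m → Fin t → ℝ) : Matrix (Fin n) (Fin n) ℝ :=
  ∑ k : Fin t, ∑ j ∈ activeSet s k,
    (s j k) ^ 2 • vecMulVec (reachVec A B (t - (k : ℕ) - 1) j) (reachVec A B (t - (k : ℕ) - 1) j)

/-- `s` is a weighted schedule with nonnegative scalings, on average at most `d` active actuators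
per step, and `(1 - ε) W(t) ⪯ W_s(t) ⪯ (1 + ε) W(t)` with `ε ∈ (0, 1)`. -/
structure IsApproximation (A : Matrix (Fin n) (Fin n) ℝ) (B : Matrix (Fin n) (Fin m) ℝ)
    (t : ℕ) (ε d : ℝ) (s : Fin m → Fin t → ℝ) : Prop where
  nonneg : ∀ i k, 0 ≤ s i k
  eps_pos : 0 < ε
  eps_lt_one : ε < 1
  average_le : (∑ k : Fin t, ((activeSet s k).card : ℝ)) / t ≤ d
  lower : (scheduleGramian A B s - (1 - ε) • gramian A B t).PosSemidef
  upper : ((1 + ε) • gramian A B t - scheduleGramian A B s).PosSemidef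

end Systems

section InverseSquareRoot

open scoped MatrixOrder

/-- `W^(-1/2)`, the inverse of the positive semidefinite square root of `W`. -/
noncomputable def invSqrt {n : ℕ} (W : Matrix (Fin n) (Fin n) ℝ) : Matrix (Fin n) (Fin n) ℝ :=
  (CFC.sqrt W)⁻¹

end InverseSquareRoot

/-! ## The greedy dual-set spectral sparsification algorithm -/

section DualSet

variable {n l : ℕ} {ι : Type}

/-- `∑_i 1 / (λ_i(A) - μ)` over the eigenvalues of `A` with multiplicity. -/
noncomputable def lowerPotential (μ : ℝ) (A : Matrix (Fin n) (Fin n) ℝ) : ℝ :=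
  (A.charpoly.roots.map fun ev => 1 / (ev - μ)).sum

/-- `∑_i 1 / (μ - λ_i(A))` over the eigenvalues of `A` with multiplicity. -/
noncomputable def upperPotential (μ : ℝ) (A : Matrix (Fin n) (Fin n) ℝ) : ℝ :=
  (A.charpoly.roots.map fun ev => 1 / (μ - ev)).sum

/-- The function `𝔏(v, δ, A, μ)`. -/
noncomputable def lowerGain (v : Fin n → ℝ) (δ : ℝ) (A : Matrix (Fin n) (Fin n) ℝ) (μ : ℝ) : ℝ :=
  v ⬝ᵥ (((A - (μ + δ) • (1 : Matrix (Fin n) (Fin n) ℝ))⁻¹ ^ 2) *ᵥ v)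
      / (lowerPotential (μ + δ) A - lowerPotential μ A)
    - v ⬝ᵥ ((A - (μ + δ) • (1 : Matrix (Fin n) (Fin n) ℝ))⁻¹ *ᵥ v)

/-- The function `𝔘(u, δ, A, μ)`. -/
noncomputable def upperGain (u : Fin n → ℝ) (δ : ℝ) (A : Matrix (Fin n) (Fin n) ℝ) (μ : ℝ) : ℝ :=
  u ⬝ᵥ ((((μ + δ) • (1 : Matrix (Fin n) (Fin n) ℝ) - A)⁻¹ ^ 2) *ᵥ u)
      / (upperPotential μ A - upperPotential (μ + δ) A)
    + u ⬝ᵥ (((μ + δ) • (1 : Matrix (Fin n) (Fin n) ℝ) - A)⁻¹ *ᵥ u)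

/-- The upper step `(1 + √(l/κ)) / (1 - √(n/κ))`; the lower step is `1`. -/
noncomputable def upperStep (n l κ : ℕ) : ℝ :=
  (1 + √((l : ℝ) / κ)) / (1 - √((n : ℝ) / κ))

/-- The lower barrier `τ - √(κ n)`. -/
noncomputable def lowerBarrier (n κ τ : ℕ) : ℝ :=
  τ - √((κ : ℝ) * n)

/-- The upper barrier `δ (τ + √(κ l))`, where `δ` is the upper step. -/
noncomputable def upperBarrier (n l κ τ : ℕ) : ℝ :=
  upperStep n l κ * (τ + √((κ : ℝ) * l))

/-- The variables of the algorithm: the weights and the lower and the upper matrix. -/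
structure DualState (n l : ℕ) (ι : Type) where
  weight : ι → ℝ
  low : Matrix (Fin n) (Fin n) ℝ
  up : Matrix (Fin l) (Fin l) ℝ

/-- `𝔏(v_i, 1, ·, ·)` at iteration `τ` in state `S`, where `v_i` is column `i` of `V`. -/
noncomputable def lowerScore (V : Matrix (Fin n) ι ℝ) (κ τ : ℕ) (S : DualState n l ι) (i : ι) : ℝ :=
  lowerGain (fun r => V r i) 1 S.low (lowerBarrier n κ τ)

/-- `𝔘(u_i, δ, ·, ·)` at iteration `τ` in state `S`, where `u_i` is column `i` of `U`. -/
noncomputable def upperScore (U : Matrix (Fin l) ι ℝ) (κ τ : ℕ) (S : DualState n l ι) (i : ι) : ℝ :=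
  upperGain (fun r => U r i) (upperStep n l κ) S.up (upperBarrier n l κ τ)

/-- The update with index `j` at iteration `τ`: with `Δ = 2 (𝔘 + 𝔏)⁻¹`, add `Δ` to the `j`-th
weight, `Δ v_j v_jᵀ` to the lower matrix and `Δ u_j u_jᵀ` to the upper matrix. -/
noncomputable def dualUpdate [DecidableEq ι] (V : Matrix (Fin n) ι ℝ) (U : Matrix (Fin l) ι ℝ)
    (κ τ : ℕ) (S : DualState n l ι) (j : ι) : DualState n l ι :=
  let Δ : ℝ := 2 * (upperScore U κ τ S j + lowerScore V κ τ S j)⁻¹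
  { weight := S.weight + Pi.single j Δ
    low := S.low + Δ • vecMulVec (fun r => V r j) (fun r => V r j)
    up := S.up + Δ • vecMulVec (fun r => U r j) (fun r => U r j) }

/-- The state before iteration `τ` if index `j τ'` is chosen at each iteration `τ' < τ`. -/
noncomputable def dualState [DecidableEq ι] (V : Matrix (Fin n) ι ℝ) (U : Matrix (Fin l) ι ℝ)
    (κ : ℕ) (j : ℕ → ι) : ℕ → DualState n l ι
  | 0 => ⟨0, 0, 0⟩
  | τ + 1 => dualUpdate V U κ τ (dualState V U κ j τ) (j τ)

/-- `c` is a possible output of `DualSet*(V, U, κ)`: there is a sequence of choices that at each of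
the `κ` iterations maximizes `𝔏 - 𝔘` over all indices (ties broken in any way), and
`c = κ⁻¹ (1 - √(n/κ)) c(κ)`. -/
def IsDualSetStarOutput [DecidableEq ι] (V : Matrix (Fin n) ι ℝ) (U : Matrix (Fin l) ι ℝ)
    (κ : ℕ) (c : ι → ℝ) : Prop :=
  ∃ j : ℕ → ι,
    (∀ τ < κ, ∀ i : ι,
      lowerScore V κ τ (dualState V U κ j τ) i - upperScore U κ τ (dualState V U κ j τ) i ≤
        lowerScore V κ τ (dualState V U κ j τ) (j τ)
          - upperScore U κ τ (dualState V U κ j τ) (j τ)) ∧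
    c = ((κ : ℝ)⁻¹ * (1 - √((n : ℝ) / κ))) • (dualState V U κ j κ).weight

end DualSet

/-- `V = (C(t) C(t)ᵀ)^(-1/2) C(t)`. -/
noncomputable def whitenedCtrb {n m : ℕ} (A : Matrix (Fin n) (Fin n) ℝ)
    (B : Matrix (Fin n) (Fin m) ℝ) (t : ℕ) : Matrix (Fin n) (Fin t × Fin m) ℝ :=
  invSqrt (ctrbMatrix A B t * (ctrbMatrix A B t)ᵀ) * ctrbMatrix A B t

/-- `s` is a possible output of the scheduling algorithm: run `DualSet*(V, V, κ)` with
`V = (C Cᵀ)^(-1/2) C`, and let the weight of the column `A^(t-1-k) b_i`, which is the one that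
actuator `i` contributes when it is used at time `k`, determine `s_i(k)`. -/
def IsAlgorithmOutput {n m : ℕ} (A : Matrix (Fin n) (Fin n) ℝ) (B : Matrix (Fin n) (Fin m) ℝ)
    (t κ : ℕ) (s : Fin m → Fin t → ℝ) : Prop :=
  ∃ c : Fin t × Fin m → ℝ,
    IsDualSetStarOutput (whitenedCtrb A B t) (whitenedCtrb A B t) κ c ∧
    s = fun i k => √(c (k.rev, i) / (1 + (n : ℝ) / κ))

/-! ## Counted real arithmetic

A program over the reals returns a value together with the number of elementary operations that it
has executed. Elementary operations are additions, subtractions, multiplications, divisions, square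
roots, comparisons and conversions of integers; copying and indexing are free. -/

structure Counted (α : Type) where
  val : α
  ops : ℕ

namespace Counted

variable {α σ : Type}

instance instMonad : Monad Counted where
  pure a := ⟨a, 0⟩
  bind x f := ⟨(f x.val).val, x.ops + (f x.val).ops⟩

def add (x y : ℝ) : Counted ℝ := ⟨x + y, 1⟩

def sub (x y : ℝ) : Counted ℝ := ⟨x - y, 1⟩

def mul (x y : ℝ) : Counted ℝ := ⟨x * y, 1⟩

noncomputable def div (x y : ℝ) : Counted ℝ := ⟨x / y, 1⟩

noncomputable def sqrt (x : ℝ) : Counted ℝ := ⟨√x, 1⟩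

noncomputable def lt (x y : ℝ) : Counted Bool :=
  ⟨@decide (x < y) (Classical.propDecidable _), 1⟩

def ofNat (k : ℕ) : Counted ℝ := ⟨k, 1⟩

/-- Fill an array: run `f i` for every index `i` and store the results. -/
def tabulate {ι : Type} [Fintype ι] (f : ι → Counted α) : Counted (ι → α) :=
  ⟨fun i => (f i).val, ∑ i, (f i).ops⟩

/-- Fill a matrix entry by entry. -/
def tabulateMatrix {ι κ : Type} [Fintype ι] [Fintype κ] (f : ι → κ → Counted ℝ) :
    Counted (Matrix ι κ ℝ) :=
  ⟨Matrix.of fun i j => (f i j).val, ∑ i, ∑ j, (f i j).ops⟩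

/-- Evaluate all `f i` and add them up, with one addition for each of them. -/
def sum {ι : Type} [Fintype ι] (f : ι → Counted ℝ) : Counted ℝ :=
  ⟨∑ i, (f i).val, ∑ i, ((f i).ops + 1)⟩

/-- A `for` loop over the list `L` with state `s`. -/
def loop (L : List α) (step : α → σ → Counted σ) (s : σ) : Counted σ :=
  match L with
  | [] => pure s
  | a :: L' => do
    let s' ← step a s
    loop L' step s'

/-- Inner product. -/
def dot {ι : Type} [Fintype ι] (v w : ι → ℝ) : Counted ℝ :=
  sum fun i => mul (v i) (w i)

/-- Matrix times vector. -/
def mulVec {ι κ : Type} [Fintype ι] [Fintype κ] (M : Matrix ι κ ℝ) (v : κ → ℝ) :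
    Counted (ι → ℝ) :=
  tabulate fun i => dot (M i) v

/-- Schoolbook matrix multiplication. -/
def matMul {ι κ μ : Type} [Fintype ι] [Fintype κ] [Fintype μ]
    (M : Matrix ι κ ℝ) (N : Matrix κ μ ℝ) : Counted (Matrix ι μ ℝ) :=
  tabulateMatrix fun i j => dot (M i) fun r => N r j

/-- The trace. -/
def trace {ι : Type} [Fintype ι] (M : Matrix ι ι ℝ) : Counted ℝ :=
  sum fun i => pure (M i i)

/-- The matrix `M - x I`. -/
def subScalar {n : ℕ} (M : Matrix (Fin n) (Fin n) ℝ) (x : ℝ) :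
    Counted (Matrix (Fin n) (Fin n) ℝ) :=
  tabulateMatrix fun i j => if i = j then sub (M i j) x else pure (M i j)

/-- The matrix `x I - M`. -/
def scalarSub {n : ℕ} (x : ℝ) (M : Matrix (Fin n) (Fin n) ℝ) :
    Counted (Matrix (Fin n) (Fin n) ℝ) :=
  tabulateMatrix fun i j => if i = j then sub x (M i j) else sub 0 (M i j)

/-- The matrix `M + x v vᵀ`. -/
def addRankOne {n : ℕ} (M : Matrix (Fin n) (Fin n) ℝ) (x : ℝ) (v : Fin n → ℝ) :
    Counted (Matrix (Fin n) (Fin n) ℝ) :=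
  tabulateMatrix fun i j => do
    let p ← mul (v i) (v j)
    let q ← mul x p
    add (M i j) q

/-- One step of Gauss-Jordan elimination without pivoting: `X` is multiplied on the left by the
elementary matrix that turns column `k` of `X * M` into the `k`-th unit vector. -/
noncomputable def gaussJordanStep {n : ℕ} (M : Matrix (Fin n) (Fin n) ℝ) (k : Fin n)
    (X : Matrix (Fin n) (Fin n) ℝ) : Counted (Matrix (Fin n) (Fin n) ℝ) := do
  let w ← mulVec X fun r => M r k
  let p ← tabulate fun j => div (X k j) (w k)
  tabulateMatrix fun i j =>
    if i = k then pure (p j)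
    else do
      let q ← mul (w i) (p j)
      sub (X i j) q

/-- Gauss-Jordan inversion without pivoting (correct for definite matrices). -/
noncomputable def inverse {n : ℕ} (M : Matrix (Fin n) (Fin n) ℝ) :
    Counted (Matrix (Fin n) (Fin n) ℝ) :=
  loop (List.finRange n) (gaussJordanStep M) 1

/-- The inverse square root is a primitive of the model. It is charged `c₀ n³` operations on an
`n × n` matrix. -/
noncomputable def inverseSqrt (c₀ : ℕ) {n : ℕ} (W : Matrix (Fin n) (Fin n) ℝ) :
    Counted (Matrix (Fin n) (Fin n) ℝ) :=
  ⟨invSqrt W, c₀ * n ^ 3⟩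

end Counted

/-! ## The counted implementation of the scheduling algorithm -/

section Programs

open Counted

variable {n l m : ℕ} {ι : Type}

/-- The quadratic forms `vᵀ P v` and `vᵀ P² v`. -/
def quadForms (P : Matrix (Fin n) (Fin n) ℝ) (v : Fin n → ℝ) : Counted (ℝ × ℝ) := do
  let w ← mulVec P v
  let z ← mulVec P w
  let a ← dot v w
  let b ← dot v z
  pure (a, b)

/-- One iteration of `DualSet*`: `δ` is the upper step and `rn`, `rl` are `√(κ n)`, `√(κ l)`.
The indices are scanned in the order of the list `enum`, and the first maximizer is taken. -/
noncomputable def dualIteration [Fintype ι] [DecidableEq ι] (enum : List ι)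
    (V : Matrix (Fin n) ι ℝ) (U : Matrix (Fin l) ι ℝ) (δ rn rl : ℝ) (τ : ℕ)
    (S : DualState n l ι) : Counted (DualState n l ι) := do
  let x ← ofNat τ
  let μ ← sub x rn
  let μ' ← add μ 1
  let y ← add x rl
  let ν ← mul δ y
  let ν' ← add ν δ
  let lowMat ← subScalar S.low μ
  let lowMat' ← subScalar S.low μ'
  let upMat ← scalarSub ν S.up
  let upMat' ← scalarSub ν' S.up
  let P ← inverse lowMat
  let P' ← inverse lowMat'
  let Q ← inverse upMat
  let Q' ← inverse upMat'
  let trP ← trace P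
  let trP' ← trace P'
  let trQ ← trace Q
  let trQ' ← trace Q'
  let dLow ← sub trP' trP
  let dUp ← sub trQ trQ'
  let low ← tabulate fun i : ι => do
    let ab ← quadForms P' fun r => V r i
    let z ← div ab.2 dLow
    sub z ab.1
  let up ← tabulate fun i : ι => do
    let ab ← quadForms Q' fun r => U r i
    let z ← div ab.2 dUp
    add z ab.1
  let best ← loop enum (fun i (b : Option (ι × ℝ)) => do
    let g ← sub (low i) (up i)
    match b with
    | none => pure (some (i, g))
    | some jh => do
      let better ← lt jh.2 g
      pure (if better then some (i, g) else b)) none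
  match best with
  | none => pure S
  | some jh => do
    let z ← add (up jh.1) (low jh.1)
    let Δ ← div 2 z
    let c ← add (S.weight jh.1) Δ
    let low' ← addRankOne S.low Δ fun r => V r jh.1
    let up' ← addRankOne S.up Δ fun r => U r jh.1
    pure ⟨Function.update S.weight jh.1 c, low', up'⟩

/-- `DualSet*(V, U, κ)`. -/
noncomputable def dualSetStar [Fintype ι] [DecidableEq ι] (enum : List ι)
    (V : Matrix (Fin n) ι ℝ) (U : Matrix (Fin l) ι ℝ) (κ : ℕ) : Counted (ι → ℝ) := do
  let xn ← ofNat n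
  let xl ← ofNat l
  let xκ ← ofNat κ
  let qn ← div xn xκ
  let ql ← div xl xκ
  let sn ← sqrt qn
  let sl ← sqrt ql
  let num ← add 1 sl
  let den ← sub 1 sn
  let δ ← div num den
  let pn ← mul xκ xn
  let pl ← mul xκ xl
  let rn ← sqrt pn
  let rl ← sqrt pl
  let S ← loop (List.range κ) (dualIteration enum V U δ rn rl) ⟨0, 0, 0⟩
  let f ← div den xκ
  tabulate fun i => mul f (S.weight i)

/-- The controllability matrix, block by block. -/
def ctrbProgram (A : Matrix (Fin n) (Fin n) ℝ) (B : Matrix (Fin n) (Fin m) ℝ) (t : ℕ) :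
    Counted (Matrix (Fin n) (Fin t × Fin m) ℝ) := do
  let S ← loop (List.finRange t)
    (fun k (S : Matrix (Fin n) (Fin m) ℝ × (Fin t → Matrix (Fin n) (Fin m) ℝ)) => do
      let next ← matMul A S.1
      pure (next, Function.update S.2 k S.1))
    (B, fun _ => 0)
  pure (Matrix.of fun r q => S.2 q.1 r q.2)

/-- The scheduling algorithm with input `A`, `B`, `t` and `κ = d t`. Its output is the schedule
`(i, k) ↦ s_i(k)`. -/
noncomputable def schedulingAlgorithm (c₀ : ℕ) (A : Matrix (Fin n) (Fin n) ℝ)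
    (B : Matrix (Fin n) (Fin m) ℝ) (t κ : ℕ) : Counted (Fin m → Fin t → ℝ) := do
  let C ← ctrbProgram A B t
  let W ← matMul C Cᵀ
  let R ← inverseSqrt c₀ W
  let V ← matMul R C
  let c ← dualSetStar ((List.finRange t).product (List.finRange m)) V V κ
  let xn ← ofNat n
  let xκ ← ofNat κ
  let q ← div xn xκ
  let e ← add 1 q
  tabulate fun i => tabulate fun k : Fin t => do
    let z ← div (c (k.rev, i)) e
    sqrt z

end Programs

end ActuatorScheduling

/-!
The schedule is obtained by spectral sparsification of the columns `v_q` of `V = (C Cᵀ)^(-1/2) C`,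
which satisfy `V Vᵀ = 1`, with the two-barrier method.

At each iteration the lower matrix lies above the lower barrier and the upper matrix below the upper
one; the potentials, which are the traces of the two resolvents (`trace_inv_sub_smul_one`,
`trace_inv_smul_one_sub`), measure how close they are. By the Sherman–Morrison formula, adding
`Δ v vᵀ` makes up for the next move of the barriers as soon as `𝔘 < 1/Δ ≤ 𝔏`
(`lower_barrier_step`, `upper_barrier_step`). Since the columns are isotropic, sums of quadratic
forms over all columns are traces. The sum of the lower gains is therefore at least
`1 - √(n/κ)` by Cauchy–Schwarz (`le_sum_lowerGain`), while the sum of the upper gains is strictly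
smaller than this number (`sum_upperGain_lt`). A maximizer `j` of `𝔏 - 𝔘` thus has `𝔘 < 𝔏`,
whatever the tie-breaking, and the mean `1/Δ` of both gains is admissible
(`DualInvariant.dualUpdate`). After `κ` steps at most `κ` weights are nonzero and the barriers become
`(1 ∓ √(n/κ))²` after scaling; conjugation by the square root of the Gramian and division by
`1 + n/κ` give `1 ∓ ε` (`IsAlgorithmOutput.isApproximation`).

The implementation replaces potentials by traces of computed inverses. All inverted matrices are
positive definite by the invariant, so that no pivot of the elimination vanishes
(`IsPartialInverse.pivot_pos`), and the program follows a sequence of greedy choices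
(`exists_greedy_dualState_eq_loop`). One iteration costs `O(n³ + t m n²)`, which is `O(t m n²)` as
`n ≤ t` and `m ≥ 1`, and there are `κ = d t` iterations (`schedulingAlgorithm_ops_le_mul`).
-/

namespace ActuatorScheduling

/-! ### Potentials and resolvents of symmetric matrices -/

section Spectral

variable {n : ℕ} {A : Matrix (Fin n) (Fin n) ℝ}

lemma lowerPotential_eq_sum (hA : A.IsHermitian) (μ : ℝ) :
    lowerPotential μ A = ∑ i, 1 / (hA.eigenvalues i - μ) := by
  simp [lowerPotential, hA.roots_charpoly_eq_eigenvalues, Function.comp_def, List.sum_ofFn]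

lemma upperPotential_eq_sum (hA : A.IsHermitian) (μ : ℝ) :
    upperPotential μ A = ∑ i, 1 / (μ - hA.eigenvalues i) := by
  simp [upperPotential, hA.roots_charpoly_eq_eigenvalues, Function.comp_def, List.sum_ofFn]

lemma exists_orthogonal_diagonalization (hA : A.IsHermitian) :
    ∃ Q : Matrix (Fin n) (Fin n) ℝ, star Q * Q = 1 ∧ Q * star Q = 1 ∧
      A = Q * diagonal hA.eigenvalues * star Q := by
  refine ⟨hA.eigenvectorUnitary, by simp, by simp, ?_⟩
  simpa [Function.comp_def] using hA.spectral_theorem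

lemma exists_orthogonal_sub_smul_one (hA : A.IsHermitian) :
    ∃ Q : Matrix (Fin n) (Fin n) ℝ, star Q * Q = 1 ∧ Q * star Q = 1 ∧ ∀ μ : ℝ,
      A - μ • (1 : Matrix (Fin n) (Fin n) ℝ)
        = Q * diagonal (fun i => hA.eigenvalues i - μ) * star Q := by
  obtain ⟨Q, h1, h2, h3⟩ := exists_orthogonal_diagonalization hA
  refine ⟨Q, h1, h2, fun μ => ?_⟩
  have : diagonal (fun i => hA.eigenvalues i - μ)
      = diagonal hA.eigenvalues - μ • (1 : Matrix (Fin n) (Fin n) ℝ) := by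
    ext i j; by_cases h : i = j <;> simp [h]
  rw [this, mul_sub, sub_mul, ← h3]
  simp [h2]

lemma posDef_sub_smul_one_iff (hA : A.IsHermitian) (μ : ℝ) :
    (A - μ • (1 : Matrix (Fin n) (Fin n) ℝ)).PosDef ↔ ∀ i, μ < hA.eigenvalues i := by
  obtain ⟨Q, h1, h2, h3⟩ := exists_orthogonal_sub_smul_one hA
  rw [h3, Matrix.IsUnit.posDef_star_right_conjugate_iff (.of_mul_eq_one _ h2), posDef_diagonal_iff]
  simp

lemma posDef_smul_one_sub_iff (hA : A.IsHermitian) (μ : ℝ) :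
    (μ • (1 : Matrix (Fin n) (Fin n) ℝ) - A).PosDef ↔ ∀ i, hA.eigenvalues i < μ := by
  obtain ⟨Q, h1, h2, h3⟩ := exists_orthogonal_sub_smul_one hA
  have : μ • (1 : Matrix (Fin n) (Fin n) ℝ) - A
      = Q * diagonal (fun i => μ - hA.eigenvalues i) * star Q := by
    rw [← neg_sub, h3, ← neg_mul, ← mul_neg, diagonal_neg]; simp
  rw [this, Matrix.IsUnit.posDef_star_right_conjugate_iff (.of_mul_eq_one _ h2),
    posDef_diagonal_iff]
  simp

lemma trace_conj_diagonal {Q : Matrix (Fin n) (Fin n) ℝ} (h1 : star Q * Q = 1)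
    (d : Fin n → ℝ) : (Q * diagonal d * star Q).trace = ∑ i, d i := by
  rw [Matrix.trace_mul_comm, ← mul_assoc, h1, one_mul, trace_diagonal]

lemma resolvent_traces (hA : A.IsHermitian) {μ : ℝ} (h : ∀ i, hA.eigenvalues i ≠ μ) :
    ((A - μ • (1 : Matrix (Fin n) (Fin n) ℝ))⁻¹).trace = ∑ i, 1 / (hA.eigenvalues i - μ) ∧
    ((A - μ • (1 : Matrix (Fin n) (Fin n) ℝ))⁻¹ ^ 2).trace
      = ∑ i, (1 / (hA.eigenvalues i - μ)) ^ 2 := by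
  obtain ⟨Q, h1, h2, h3⟩ := exists_orthogonal_sub_smul_one hA
  have key : (A - μ • (1 : Matrix (Fin n) (Fin n) ℝ))⁻¹
      = Q * diagonal (fun i => 1 / (hA.eigenvalues i - μ)) * star Q := by
    apply Matrix.inv_eq_left_inv
    rw [h3]
    calc _ = Q * (diagonal (fun i => 1 / (hA.eigenvalues i - μ)) * (star Q * Q)
          * diagonal (fun i => hA.eigenvalues i - μ)) * star Q := by simp only [mul_assoc]
      _ = 1 := by
        rw [h1, mul_one, diagonal_mul_diagonal]
        have : (fun i => 1 / (hA.eigenvalues i - μ) * (hA.eigenvalues i - μ)) = fun _ => 1 := by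
          ext i; have := sub_ne_zero.2 (h i); field_simp
        rw [this, diagonal_one, mul_one, h2]
  rw [key]
  refine ⟨trace_conj_diagonal h1 _, ?_⟩
  have : (Q * diagonal (fun i => 1 / (hA.eigenvalues i - μ)) * star Q) ^ 2
      = Q * diagonal (fun i => (1 / (hA.eigenvalues i - μ)) ^ 2) * star Q := by
    calc _ = Q * (diagonal (fun i => 1 / (hA.eigenvalues i - μ)) * (star Q * Q)
          * diagonal (fun i => 1 / (hA.eigenvalues i - μ))) * star Q := by
            simp only [mul_assoc, pow_two]
      _ = _ := by
        rw [h1, mul_one, diagonal_mul_diagonal]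
        simp only [pow_two]
  rw [this, trace_conj_diagonal h1]

lemma trace_inv_sub_smul_one (hA : A.IsHermitian) {μ : ℝ}
    (h : (A - μ • (1 : Matrix (Fin n) (Fin n) ℝ)).PosDef) :
    ((A - μ • (1 : Matrix (Fin n) (Fin n) ℝ))⁻¹).trace = lowerPotential μ A := by
  rw [lowerPotential_eq_sum hA]
  exact (resolvent_traces hA fun i => ((posDef_sub_smul_one_iff hA μ).1 h i).ne').1

lemma inv_smul_one_sub (A : Matrix (Fin n) (Fin n) ℝ) (μ : ℝ) :
    (μ • (1 : Matrix (Fin n) (Fin n) ℝ) - A)⁻¹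
      = -(A - μ • (1 : Matrix (Fin n) (Fin n) ℝ))⁻¹ := by
  by_cases h : IsUnit (A - μ • (1 : Matrix (Fin n) (Fin n) ℝ)).det
  · apply Matrix.inv_eq_left_inv
    rw [← neg_sub A (μ • 1), neg_mul_neg, nonsing_inv_mul _ h]
  · rw [nonsing_inv_apply_not_isUnit _ h, nonsing_inv_apply_not_isUnit, neg_zero]
    rw [← neg_sub, det_neg]
    simpa [isUnit_iff_ne_zero] using h

lemma trace_inv_smul_one_sub (hA : A.IsHermitian) {μ : ℝ}
    (h : (μ • (1 : Matrix (Fin n) (Fin n) ℝ) - A).PosDef) :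
    ((μ • (1 : Matrix (Fin n) (Fin n) ℝ) - A)⁻¹).trace = upperPotential μ A := by
  rw [upperPotential_eq_sum hA, inv_smul_one_sub, trace_neg,
    (resolvent_traces hA fun i => ((posDef_smul_one_sub_iff hA μ).1 h i).ne).1,
    ← Finset.sum_neg_distrib]
  exact Finset.sum_congr rfl fun i _ => by rw [← neg_sub μ, one_div, one_div, inv_neg, neg_neg]

lemma trace_inv_sub_smul_one_sq (hA : A.IsHermitian) {μ : ℝ}
    (h : (A - μ • (1 : Matrix (Fin n) (Fin n) ℝ)).PosDef) :
    ((A - μ • (1 : Matrix (Fin n) (Fin n) ℝ))⁻¹ ^ 2).trace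
      = ∑ i, (1 / (hA.eigenvalues i - μ)) ^ 2 :=
  (resolvent_traces hA fun i => ((posDef_sub_smul_one_iff hA μ).1 h i).ne').2

lemma trace_inv_smul_one_sub_sq (hA : A.IsHermitian) {μ : ℝ}
    (h : (μ • (1 : Matrix (Fin n) (Fin n) ℝ) - A).PosDef) :
    ((μ • (1 : Matrix (Fin n) (Fin n) ℝ) - A)⁻¹ ^ 2).trace
      = ∑ i, (1 / (μ - hA.eigenvalues i)) ^ 2 := by
  rw [inv_smul_one_sub, neg_sq,
    (resolvent_traces hA fun i => ((posDef_smul_one_sub_iff hA μ).1 h i).ne).2]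
  exact Finset.sum_congr rfl fun i _ => by rw [← neg_sub μ, one_div, one_div, inv_neg, neg_sq]

end Spectral

/-! ### Rank-one perturbations of positive definite matrices -/

section RankOne

variable {n : ℕ} {M : Matrix (Fin n) (Fin n) ℝ}

/-- The Sherman–Morrison formula for a symmetric rank-one perturbation. -/
lemma inv_add_smul_vecMulVec (hM : M.PosDef) (v : Fin n → ℝ) {s : ℝ}
    (hs : 1 + s * (v ⬝ᵥ M⁻¹ *ᵥ v) ≠ 0) :
    (M + s • vecMulVec v v)⁻¹
      = M⁻¹ - (s / (1 + s * (v ⬝ᵥ M⁻¹ *ᵥ v))) • vecMulVec (M⁻¹ *ᵥ v) (M⁻¹ *ᵥ v) := by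
  have hdet : IsUnit M.det := (Matrix.isUnit_iff_isUnit_det _).1 hM.isUnit
  have hsymm : v ᵥ* M⁻¹ = M⁻¹ *ᵥ v := by
    have : (M⁻¹)ᵀ = M⁻¹ := by simpa using hM.inv.isHermitian.eq
    conv_rhs => rw [← this, mulVec_transpose]
  apply Matrix.inv_eq_right_inv
  have e1 : M * vecMulVec (M⁻¹ *ᵥ v) (M⁻¹ *ᵥ v) = vecMulVec v (M⁻¹ *ᵥ v) := by
    rw [mul_vecMulVec, mulVec_mulVec, mul_nonsing_inv _ hdet, one_mulVec]
  have e2 : vecMulVec v v * M⁻¹ = vecMulVec v (M⁻¹ *ᵥ v) := by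
    rw [vecMulVec_mul, hsymm]
  have e3 : vecMulVec v v * vecMulVec (M⁻¹ *ᵥ v) (M⁻¹ *ᵥ v)
      = (v ⬝ᵥ M⁻¹ *ᵥ v) • vecMulVec v (M⁻¹ *ᵥ v) := by
    rw [vecMulVec_mul_vecMulVec, vecMulVec_smul]
  rw [add_mul, mul_sub, mul_sub, mul_nonsing_inv _ hdet, mul_smul_comm, e1, smul_mul_assoc, e2,
    smul_mul_smul_comm, e3, smul_smul]
  have : s - s / (1 + s * (v ⬝ᵥ M⁻¹ *ᵥ v)) -
      s * (s / (1 + s * (v ⬝ᵥ M⁻¹ *ᵥ v))) * (v ⬝ᵥ M⁻¹ *ᵥ v) = 0 := by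
    field_simp; ring
  calc _ = 1 + (s - s / (1 + s * (v ⬝ᵥ M⁻¹ *ᵥ v)) -
      s * (s / (1 + s * (v ⬝ᵥ M⁻¹ *ᵥ v))) * (v ⬝ᵥ M⁻¹ *ᵥ v)) • vecMulVec v (M⁻¹ *ᵥ v) := by
        module
    _ = 1 := by rw [this, zero_smul, add_zero]

lemma trace_inv_add_smul_vecMulVec (hM : M.PosDef) (v : Fin n → ℝ) {s : ℝ}
    (hs : 1 + s * (v ⬝ᵥ M⁻¹ *ᵥ v) ≠ 0) :
    ((M + s • vecMulVec v v)⁻¹).trace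
      = (M⁻¹).trace - s * (v ⬝ᵥ (M⁻¹ ^ 2) *ᵥ v) / (1 + s * (v ⬝ᵥ M⁻¹ *ᵥ v)) := by
  have hsymm : v ᵥ* M⁻¹ = M⁻¹ *ᵥ v := by
    have : (M⁻¹)ᵀ = M⁻¹ := by simpa using hM.inv.isHermitian.eq
    conv_rhs => rw [← this, mulVec_transpose]
  have e : v ⬝ᵥ (M⁻¹ ^ 2) *ᵥ v = (M⁻¹ *ᵥ v) ⬝ᵥ (M⁻¹ *ᵥ v) := by
    rw [pow_two, ← mulVec_mulVec, dotProduct_mulVec, hsymm]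
  rw [inv_add_smul_vecMulVec hM v hs, trace_sub, trace_smul, trace_vecMulVec, e, smul_eq_mul]
  ring

lemma posDef_add_smul_vecMulVec (hM : M.PosDef) (v : Fin n → ℝ) {s : ℝ} (hs : 0 ≤ s) :
    (M + s • vecMulVec v v).PosDef :=
  hM.add_posSemidef (PosSemidef.smul (by simpa using posSemidef_vecMulVec_self_star v) hs)

lemma posDef_sub_smul_vecMulVec (hM : M.PosDef) (v : Fin n → ℝ) {s : ℝ} (hs : 0 < s)
    (h : s * (v ⬝ᵥ M⁻¹ *ᵥ v) < 1) : (M - s • vecMulVec v v).PosDef := by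
  have hdet : IsUnit M.det := (Matrix.isUnit_iff_isUnit_det _).1 hM.isUnit
  have hT : Mᵀ = M := by simpa using hM.isHermitian.eq
  refine PosDef.of_dotProduct_mulVec_pos (hM.isHermitian.sub ?_) fun x hx => ?_
  · exact (PosSemidef.smul (by simpa using posSemidef_vecMulVec_self_star v) hs.le).isHermitian
  have hx0 := hM.dotProduct_mulVec_pos hx
  simp only [star_trivial] at hx0 ⊢
  -- Nonnegativity of the form at `x - s (v ⬝ᵥ x) M⁻¹ v` bounds `s (v ⬝ᵥ x)²`.
  have key := hM.posSemidef.dotProduct_mulVec_nonneg (x - (s * (v ⬝ᵥ x)) • (M⁻¹ *ᵥ v))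
  have e1 : M *ᵥ (M⁻¹ *ᵥ v) = v := by rw [mulVec_mulVec, mul_nonsing_inv _ hdet, one_mulVec]
  have e2 : (M⁻¹ *ᵥ v) ⬝ᵥ M *ᵥ x = v ⬝ᵥ x := by
    rw [dotProduct_mulVec, ← mulVec_transpose, hT, e1]
  simp only [star_trivial, mulVec_sub, mulVec_smul, e1, sub_dotProduct, dotProduct_sub,
    smul_dotProduct, dotProduct_smul, e2, smul_eq_mul] at key
  rw [dotProduct_comm x v, dotProduct_comm (M⁻¹ *ᵥ v) v] at key
  rw [sub_mulVec, dotProduct_sub, smul_mulVec, vecMulVec_mulVec, dotProduct_smul]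
  simp only [dotProduct_smul, smul_eq_mul, op_smul_eq_smul, dotProduct_comm x v]
  rcases eq_or_ne (v ⬝ᵥ x) 0 with h0 | h0
  · rw [h0] at key ⊢; simpa using hx0
  · have : 0 < s * (v ⬝ᵥ x) ^ 2 * (1 - s * (v ⬝ᵥ M⁻¹ *ᵥ v)) := by
      have := pow_pos (abs_pos.2 h0) 2
      rw [sq_abs] at this
      have := sub_pos.2 h
      positivity
    nlinarith

end RankOne

/-! ### Gains and barrier steps -/

section Barriers

variable {n : ℕ} {ι : Type} {A : Matrix (Fin n) (Fin n) ℝ}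

lemma sum_quadratic_form_columns [Fintype ι] {V : Matrix (Fin n) ι ℝ} (hV : V * Vᵀ = 1)
    (P : Matrix (Fin n) (Fin n) ℝ) :
    ∑ i, (fun r => V r i) ⬝ᵥ P *ᵥ (fun r => V r i) = P.trace := by
  calc _ = (Vᵀ * (P * V)).trace := rfl
    _ = P.trace := by rw [trace_mul_comm, Matrix.mul_assoc, hV, mul_one]

/-- The scalar inequality behind the averaged lower gain: `D = ∑ 1/(x-1) - ∑ 1/x` equals
`∑ 1/((x-1)x)`, and Cauchy–Schwarz bounds `D²` by `∑ 1/((x-1)²x)`. -/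
lemma one_sub_sum_le_of_one_lt [NeZero n] (x : Fin n → ℝ) (hx : ∀ i, 1 < x i)
    (hsum : ∑ i, 1 / x i ≤ 1) :
    1 - ∑ i, 1 / x i ≤
      (∑ i, (1 / (x i - 1)) ^ 2) / (∑ i, 1 / (x i - 1) - ∑ i, 1 / x i) - ∑ i, 1 / (x i - 1) := by
  have hx0 : ∀ i, 0 < x i := fun i => one_pos.trans (hx i)
  have hx1 : ∀ i, 0 < x i - 1 := fun i => sub_pos.2 (hx i)
  set D := ∑ i, 1 / (x i - 1) - ∑ i, 1 / x i with hD
  have hD1 : D = ∑ i, 1 / (x i - 1) * (1 / x i) := by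
    rw [hD, ← Finset.sum_sub_distrib]
    refine Finset.sum_congr rfl fun i _ => ?_
    have := hx0 i; have := hx1 i
    field_simp; ring
  have hDpos : 0 < D := by
    rw [hD1]
    exact Finset.sum_pos (fun i _ => mul_pos (one_div_pos.2 (hx1 i)) (one_div_pos.2 (hx0 i)))
      Finset.univ_nonempty
  have hsq : ∑ i, (1 / (x i - 1)) ^ 2 = D + ∑ i, (1 / (x i - 1)) ^ 2 * (1 / x i) := by
    rw [hD1, ← Finset.sum_add_distrib]
    refine Finset.sum_congr rfl fun i _ => ?_
    have := hx0 i; have := hx1 i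
    field_simp; ring
  have hcs : D ^ 2 ≤ (∑ i, (1 / (x i - 1)) ^ 2 * (1 / x i)) * ∑ i, 1 / x i := by
    rw [hD1]
    refine Finset.sum_sq_le_sum_mul_sum_of_sq_le_mul _ (fun i _ => ?_) (fun i _ => ?_)
      fun i _ => le_of_eq (by ring)
    · have := one_div_pos.2 (hx0 i); positivity
    · exact (one_div_pos.2 (hx0 i)).le
  have hE : 0 ≤ ∑ i, (1 / (x i - 1)) ^ 2 * (1 / x i) :=
    Finset.sum_nonneg fun i _ => by have := one_div_pos.2 (hx0 i); positivity
  have hfin : (1 + D) * D ≤ ∑ i, (1 / (x i - 1)) ^ 2 := by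
    rw [hsq]; nlinarith
  have := (le_div_iff₀ hDpos).2 hfin
  linarith

lemma sum_div_add_sum_lt [NeZero n] (y : Fin n → ℝ) (hy : ∀ i, 0 < y i) {δ : ℝ} (hδ : 0 < δ) :
    (∑ i, (1 / (y i + δ)) ^ 2) / (∑ i, 1 / y i - ∑ i, 1 / (y i + δ)) + ∑ i, 1 / (y i + δ)
      < 1 / δ + ∑ i, 1 / y i := by
  have hyd : ∀ i, 0 < y i + δ := fun i => add_pos (hy i) hδ
  set D := ∑ i, 1 / y i - ∑ i, 1 / (y i + δ) with hD
  have hD1 : D = δ * ∑ i, 1 / (y i + δ) * (1 / y i) := by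
    rw [hD, ← Finset.sum_sub_distrib, Finset.mul_sum]
    refine Finset.sum_congr rfl fun i _ => ?_
    have := hy i; have := hyd i
    field_simp; ring
  have hpos : 0 < ∑ i, 1 / (y i + δ) * (1 / y i) :=
    Finset.sum_pos (fun i _ => mul_pos (one_div_pos.2 (hyd i)) (one_div_pos.2 (hy i)))
      Finset.univ_nonempty
  have hDpos : 0 < D := by rw [hD1]; positivity
  have hlt : ∑ i, (1 / (y i + δ)) ^ 2 < ∑ i, 1 / (y i + δ) * (1 / y i) := by
    refine Finset.sum_lt_sum_of_nonempty Finset.univ_nonempty fun i _ => ?_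
    rw [pow_two]
    exact mul_lt_mul_of_pos_left (one_div_lt_one_div_of_lt (hy i) (by linarith))
      (one_div_pos.2 (hyd i))
  have : (∑ i, (1 / (y i + δ)) ^ 2) / D < 1 / δ := by
    rw [div_lt_div_iff₀ hDpos hδ, hD1]; nlinarith
  linarith

/-- Each summand of the potential is less than `1`, so every eigenvalue exceeds `μ + 1`. -/
lemma posDef_sub_add_one_smul (hA : A.IsHermitian) {μ : ℝ}
    (hpd : (A - μ • (1 : Matrix (Fin n) (Fin n) ℝ)).PosDef) (hφ : lowerPotential μ A < 1) :
    (A - (μ + 1) • (1 : Matrix (Fin n) (Fin n) ℝ)).PosDef := by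
  rw [posDef_sub_smul_one_iff hA] at hpd ⊢
  rw [lowerPotential_eq_sum hA] at hφ
  intro i
  have hi : 0 < hA.eigenvalues i - μ := sub_pos.2 (hpd i)
  have : 1 / (hA.eigenvalues i - μ) < 1 := (Finset.single_le_sum
    (f := fun i => 1 / (hA.eigenvalues i - μ))
    (fun j _ => (one_div_pos.2 (sub_pos.2 (hpd j))).le) (Finset.mem_univ i)).trans_lt hφ
  rw [div_lt_one hi] at this
  linarith

lemma posDef_add_smul_sub (hA : A.IsHermitian) {ν δ : ℝ} (hδ : 0 < δ)
    (hpd : (ν • (1 : Matrix (Fin n) (Fin n) ℝ) - A).PosDef) :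
    ((ν + δ) • (1 : Matrix (Fin n) (Fin n) ℝ) - A).PosDef := by
  rw [posDef_smul_one_sub_iff hA] at hpd ⊢
  exact fun i => (hpd i).trans (by linarith)

lemma lowerPotential_lt_lowerPotential [NeZero n] (hA : A.IsHermitian) {μ : ℝ}
    (hpd : (A - (μ + 1) • (1 : Matrix (Fin n) (Fin n) ℝ)).PosDef) :
    lowerPotential μ A < lowerPotential (μ + 1) A := by
  rw [posDef_sub_smul_one_iff hA] at hpd
  rw [lowerPotential_eq_sum hA, lowerPotential_eq_sum hA]
  exact Finset.sum_lt_sum_of_nonempty Finset.univ_nonempty fun i _ =>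
    one_div_lt_one_div_of_lt (by linarith [hpd i]) (by linarith)

lemma upperPotential_lt_upperPotential [NeZero n] (hA : A.IsHermitian) {ν δ : ℝ} (hδ : 0 < δ)
    (hpd : (ν • (1 : Matrix (Fin n) (Fin n) ℝ) - A).PosDef) :
    upperPotential (ν + δ) A < upperPotential ν A := by
  rw [posDef_smul_one_sub_iff hA] at hpd
  rw [upperPotential_eq_sum hA, upperPotential_eq_sum hA]
  exact Finset.sum_lt_sum_of_nonempty Finset.univ_nonempty fun i _ =>
    one_div_lt_one_div_of_lt (by linarith [hpd i]) (by linarith)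

/-- The total lower gain of an isotropic family of columns. That the potential is below `1` keeps
the spectrum above the next barrier `μ + 1`. -/
lemma le_sum_lowerGain [NeZero n] [Fintype ι] {V : Matrix (Fin n) ι ℝ} (hV : V * Vᵀ = 1)
    (hA : A.IsHermitian) {μ : ℝ} (hpd : (A - μ • (1 : Matrix (Fin n) (Fin n) ℝ)).PosDef)
    (hφ : lowerPotential μ A < 1) :
    1 - lowerPotential μ A ≤ ∑ i, lowerGain (fun r => V r i) 1 A μ := by
  have hpd' := posDef_sub_add_one_smul hA hpd hφ
  simp only [lowerGain, Finset.sum_sub_distrib, ← Finset.sum_div]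
  rw [sum_quadratic_form_columns hV, sum_quadratic_form_columns hV,
    trace_inv_sub_smul_one_sq hA hpd', trace_inv_sub_smul_one hA hpd']
  simp only [lowerPotential_eq_sum hA] at hφ ⊢
  rw [posDef_sub_smul_one_iff hA] at hpd'
  simpa only [sub_sub] using one_sub_sum_le_of_one_lt (fun i => hA.eigenvalues i - μ)
    (fun i => by linarith [hpd' i]) hφ.le

/-- The total upper gain of an isotropic family. The strictness of this bound is what excludes zero
columns, for which both gains vanish, from the greedy choices. -/
lemma sum_upperGain_lt [NeZero n] [Fintype ι] {U : Matrix (Fin n) ι ℝ} (hU : U * Uᵀ = 1)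
    (hA : A.IsHermitian) {ν δ : ℝ} (hδ : 0 < δ)
    (hpd : (ν • (1 : Matrix (Fin n) (Fin n) ℝ) - A).PosDef) :
    ∑ i, upperGain (fun r => U r i) δ A ν < 1 / δ + upperPotential ν A := by
  have hpd' := posDef_add_smul_sub hA hδ hpd
  simp only [upperGain, Finset.sum_add_distrib, ← Finset.sum_div]
  rw [sum_quadratic_form_columns hU, sum_quadratic_form_columns hU,
    trace_inv_smul_one_sub_sq hA hpd', trace_inv_smul_one_sub hA hpd']
  simp only [upperPotential_eq_sum hA]
  rw [posDef_smul_one_sub_iff hA] at hpd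
  simpa only [sub_add_eq_add_sub] using sum_div_add_sum_lt (fun i => ν - hA.eigenvalues i)
    (fun i => by linarith [hpd i]) hδ

lemma isHermitian_add_smul_vecMulVec (hA : A.IsHermitian) (v : Fin n → ℝ) (s : ℝ) :
    (A + s • vecMulVec v v).IsHermitian := by
  apply hA.add
  rw [IsHermitian, conjTranspose_smul, star_trivial,
    (show (vecMulVec v v).IsHermitian by
      simpa using (posSemidef_vecMulVec_self_star v).isHermitian)]

lemma quadratic_form_inv_sq_nonneg {M : Matrix (Fin n) (Fin n) ℝ} (hM : M.PosDef)
    (v : Fin n → ℝ) : 0 ≤ v ⬝ᵥ (M⁻¹ ^ 2) *ᵥ v := by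
  simpa using (hM.inv.posSemidef.pow 2).dotProduct_mulVec_nonneg v

/-- If `1/Δ` is at most the lower gain of `v`, then adding `Δ v vᵀ` pays for moving the lower
barrier up by one. -/
lemma lower_barrier_step [NeZero n] (hA : A.IsHermitian) {μ : ℝ}
    (hpd : (A - (μ + 1) • (1 : Matrix (Fin n) (Fin n) ℝ)).PosDef) (v : Fin n → ℝ) {Δ : ℝ}
    (hΔ : 0 < Δ) (hgain : Δ⁻¹ ≤ lowerGain v 1 A μ) :
    (A + Δ • vecMulVec v v - (μ + 1) • (1 : Matrix (Fin n) (Fin n) ℝ)).PosDef ∧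
      lowerPotential (μ + 1) (A + Δ • vecMulVec v v) ≤ lowerPotential μ A := by
  have hrw : A + Δ • vecMulVec v v - (μ + 1) • (1 : Matrix (Fin n) (Fin n) ℝ)
    = A - (μ + 1) • (1 : Matrix (Fin n) (Fin n) ℝ) + Δ • vecMulVec v v := by abel
  have hpos : (A + Δ • vecMulVec v v - (μ + 1) • (1 : Matrix (Fin n) (Fin n) ℝ)).PosDef := by
    rw [hrw]; exact posDef_add_smul_vecMulVec hpd v hΔ.le
  refine ⟨hpos, ?_⟩
  have hD := sub_pos.2 (lowerPotential_lt_lowerPotential hA hpd)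
  have hq : 0 ≤ v ⬝ᵥ ((A - (μ + 1) • (1 : Matrix (Fin n) (Fin n) ℝ))⁻¹) *ᵥ v := by
    simpa using hpd.inv.posSemidef.dotProduct_mulVec_nonneg v
  rw [← trace_inv_sub_smul_one (isHermitian_add_smul_vecMulVec hA v Δ) hpos, hrw,
    trace_inv_add_smul_vecMulVec hpd v (by positivity), trace_inv_sub_smul_one hA hpd]
  rw [lowerGain] at hgain
  set q1 := v ⬝ᵥ ((A - (μ + 1) • (1 : Matrix (Fin n) (Fin n) ℝ))⁻¹) *ᵥ v
  set q2 := v ⬝ᵥ ((A - (μ + 1) • (1 : Matrix (Fin n) (Fin n) ℝ))⁻¹ ^ 2) *ᵥ v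
  set D := lowerPotential (μ + 1) A - lowerPotential μ A with hDdef
  have h1 : (Δ⁻¹ + q1) * D ≤ q2 := (le_div_iff₀ hD).1 (by linarith)
  have h2 : D ≤ Δ * q2 / (1 + Δ * q1) := by
    rw [le_div_iff₀ (by positivity)]
    calc D * (1 + Δ * q1) = Δ * ((Δ⁻¹ + q1) * D) := by field_simp
      _ ≤ Δ * q2 := mul_le_mul_of_nonneg_left h1 hΔ.le
  linarith

/-- If `1/Δ` exceeds the upper gain of `u`, then moving the upper barrier up by `δ` makes room for
adding `Δ u uᵀ`. -/
lemma upper_barrier_step [NeZero n] (hA : A.IsHermitian) {ν δ : ℝ} (hδ : 0 < δ)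
    (hpd : (ν • (1 : Matrix (Fin n) (Fin n) ℝ) - A).PosDef) (u : Fin n → ℝ) {Δ : ℝ}
    (hΔ : 0 < Δ) (hgain : upperGain u δ A ν < Δ⁻¹) :
    ((ν + δ) • (1 : Matrix (Fin n) (Fin n) ℝ) - (A + Δ • vecMulVec u u)).PosDef ∧
      upperPotential (ν + δ) (A + Δ • vecMulVec u u) ≤ upperPotential ν A := by
  have hD := sub_pos.2 (upperPotential_lt_upperPotential hA hδ hpd)
  replace hpd := posDef_add_smul_sub hA hδ hpd
  rw [upperGain] at hgain
  have hq2 := quadratic_form_inv_sq_nonneg hpd u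
  have hrw : (ν + δ) • (1 : Matrix (Fin n) (Fin n) ℝ) - (A + Δ • vecMulVec u u)
    = (ν + δ) • (1 : Matrix (Fin n) (Fin n) ℝ) - A + (-Δ) • vecMulVec u u := by
      rw [neg_smul]; abel
  have hpos1 : 0 < Δ⁻¹ - u ⬝ᵥ (((ν + δ) • (1 : Matrix (Fin n) (Fin n) ℝ) - A)⁻¹) *ᵥ u := by
    have := div_nonneg hq2 hD.le
    linarith
  have hpos2 : 0 < 1 - Δ * (u ⬝ᵥ (((ν + δ) • (1 : Matrix (Fin n) (Fin n) ℝ) - A)⁻¹) *ᵥ u) := by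
    have := mul_pos hΔ hpos1
    rwa [mul_sub, mul_inv_cancel₀ hΔ.ne'] at this
  have hpos : ((ν + δ) • (1 : Matrix (Fin n) (Fin n) ℝ) - (A + Δ • vecMulVec u u)).PosDef := by
    rw [hrw, neg_smul, ← sub_eq_add_neg]
    exact posDef_sub_smul_vecMulVec hpd u hΔ (by linarith)
  refine ⟨hpos, ?_⟩
  rw [← trace_inv_smul_one_sub (isHermitian_add_smul_vecMulVec hA u Δ) hpos, hrw,
    trace_inv_add_smul_vecMulVec hpd u (by linarith), trace_inv_smul_one_sub hA hpd]
  set q1 := u ⬝ᵥ (((ν + δ) • (1 : Matrix (Fin n) (Fin n) ℝ) - A)⁻¹) *ᵥ u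
  set q2 := u ⬝ᵥ (((ν + δ) • (1 : Matrix (Fin n) (Fin n) ℝ) - A)⁻¹ ^ 2) *ᵥ u
  set D := upperPotential ν A - upperPotential (ν + δ) A with hDdef
  have h1 : q2 ≤ (Δ⁻¹ - q1) * D := (div_le_iff₀ hD).1 (by linarith)
  have h2 : Δ * q2 / (1 - Δ * q1) ≤ D := by
    rw [div_le_iff₀ hpos2]
    calc Δ * q2 ≤ Δ * ((Δ⁻¹ - q1) * D) := mul_le_mul_of_nonneg_left h1 hΔ.le
      _ = D * (1 - Δ * q1) := by field_simp
  have h3 : -Δ * q2 / (1 + -Δ * q1) = -(Δ * q2 / (1 - Δ * q1)) := by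
    rw [neg_mul, neg_mul, neg_div, sub_eq_add_neg]
  rw [h3]
  linarith

lemma upperGain_nonneg [NeZero n] (hA : A.IsHermitian) {ν δ : ℝ} (hδ : 0 < δ)
    (hpd : (ν • (1 : Matrix (Fin n) (Fin n) ℝ) - A).PosDef) (u : Fin n → ℝ) :
    0 ≤ upperGain u δ A ν := by
  have hD := sub_pos.2 (upperPotential_lt_upperPotential hA hδ hpd)
  replace hpd := posDef_add_smul_sub hA hδ hpd
  have hq1 := hpd.inv.posSemidef.dotProduct_mulVec_nonneg u
  rw [star_trivial] at hq1
  exact add_nonneg (div_nonneg (quadratic_form_inv_sq_nonneg hpd u) hD.le) hq1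

end Barriers

/-! ### The invariant of the greedy choices -/

section DualSetAnalysis

variable {n l : ℕ} {ι : Type} [Fintype ι] {V : Matrix (Fin n) ι ℝ} {U : Matrix (Fin l) ι ℝ}
  {κ : ℕ}

/-- What holds before iteration `τ` if all choices so far were greedy: both matrices lie strictly on
their side of their barrier, with potentials no larger than initially, and they are the weighted
sums of the rank-one matrices of the columns, with at most `τ` nonzero weights. -/
structure DualInvariant (V : Matrix (Fin n) ι ℝ) (U : Matrix (Fin l) ι ℝ) (κ τ : ℕ)
    (S : DualState n l ι) : Prop where
  low_isHermitian : S.low.IsHermitian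
  low_posDef : (S.low - lowerBarrier n κ τ • (1 : Matrix (Fin n) (Fin n) ℝ)).PosDef
  low_potential : lowerPotential (lowerBarrier n κ τ) S.low ≤ √((n : ℝ) / κ)
  up_isHermitian : S.up.IsHermitian
  up_posDef : (upperBarrier n l κ τ • (1 : Matrix (Fin l) (Fin l) ℝ) - S.up).PosDef
  up_potential : upperPotential (upperBarrier n l κ τ) S.up ≤ √((l : ℝ) / κ) / upperStep n l κ
  weight_nonneg : ∀ i, 0 ≤ S.weight i
  low_eq : S.low = ∑ i, S.weight i • vecMulVec (fun r => V r i) (fun r => V r i)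
  up_eq : S.up = ∑ i, S.weight i • vecMulVec (fun r => U r i) (fun r => U r i)
  card_le : (Finset.univ.filter fun i => S.weight i ≠ 0).card ≤ τ

/-- Index `j` maximizes `𝔏 - 𝔘` at iteration `τ` in state `S`. -/
def IsGreedyChoice (V : Matrix (Fin n) ι ℝ) (U : Matrix (Fin l) ι ℝ) (κ τ : ℕ)
    (S : DualState n l ι) (j : ι) : Prop :=
  ∀ i : ι, lowerScore V κ τ S i - upperScore U κ τ S i ≤
    lowerScore V κ τ S j - upperScore U κ τ S j

lemma sqrt_div_lt_one (hκ : n < κ) : √((n : ℝ) / κ) < 1 := by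
  have h : (n : ℝ) < κ := by exact_mod_cast hκ
  have : (0 : ℝ) ≤ n := n.cast_nonneg
  rw [Real.sqrt_lt' one_pos, one_pow, div_lt_one (by linarith)]
  exact h

lemma upperStep_pos (hκ : n < κ) : 0 < upperStep n l κ :=
  div_pos (by positivity) (sub_pos.2 (sqrt_div_lt_one hκ))

lemma lowerBarrier_succ (n κ τ : ℕ) : lowerBarrier n κ (τ + 1) = lowerBarrier n κ τ + 1 := by
  simp only [lowerBarrier]; push_cast; ring

lemma upperBarrier_succ (n l κ τ : ℕ) :
    upperBarrier n l κ (τ + 1) = upperBarrier n l κ τ + upperStep n l κ := by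
  simp only [upperBarrier]; push_cast; ring

lemma natCast_div_sqrt_mul {a b : ℕ} (ha : 0 < a) (hb : 0 < b) :
    (a : ℝ) / √((b : ℝ) * a) = √((a : ℝ) / b) := by
  have h1 : (0 : ℝ) < a := by exact_mod_cast ha
  have h2 : (0 : ℝ) < b := by exact_mod_cast hb
  rw [Real.sqrt_mul h2.le, Real.sqrt_div h1.le, div_eq_div_iff (by positivity) (by positivity)]
  rw [mul_left_comm, Real.mul_self_sqrt h1.le, mul_comm]

lemma dualInvariant_zero [NeZero n] [NeZero l] (hκ : n < κ) :
    DualInvariant V U κ 0 (⟨0, 0, 0⟩ : DualState n l ι) := by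
  have hn := NeZero.pos n
  have hl := NeZero.pos l
  have hδ : 0 < upperStep n l κ := upperStep_pos hκ
  have hκ0 : 0 < κ := by omega
  have h1 : (0 : ℝ) < n := by exact_mod_cast hn
  have h2 : (0 : ℝ) < κ := by exact_mod_cast hκ0
  have h3 : (0 : ℝ) < l := by exact_mod_cast hl
  have e1 : lowerBarrier n κ 0 = -√((κ : ℝ) * n) := by simp [lowerBarrier]
  have e2 : upperBarrier n l κ 0 = upperStep n l κ * √((κ : ℝ) * l) := by simp [upperBarrier]
  refine ⟨isHermitian_zero, ?_, ?_, isHermitian_zero, ?_, ?_, fun i => le_rfl, by simp, by simp,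
    by simp⟩
  · rw [e1, zero_sub, neg_smul, neg_neg]
    exact PosDef.one.smul (by positivity)
  · rw [e1, ← natCast_div_sqrt_mul hn hκ0]
    rw [lowerPotential, charpoly_zero, Polynomial.roots_X_pow, Multiset.map_nsmul,
      Multiset.sum_nsmul]
    simp [div_eq_mul_inv]
  · rw [e2, sub_zero]
    exact PosDef.one.smul (by positivity)
  · rw [e2, ← natCast_div_sqrt_mul hl hκ0]
    rw [upperPotential, charpoly_zero, Polynomial.roots_X_pow, Multiset.map_nsmul,
      Multiset.sum_nsmul]
    simp [div_eq_mul_inv, mul_comm, mul_left_comm]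

/-- Averaging over all indices: the lower gains add up to more than the upper gains, so some index,
and hence every maximizer, has a lower gain that exceeds its upper gain. -/
lemma upperScore_lt_lowerScore [NeZero n] [NeZero l] (hV : V * Vᵀ = 1) (hU : U * Uᵀ = 1)
    (hκ : n < κ) {τ : ℕ} {S : DualState n l ι} (hS : DualInvariant V U κ τ S) {j : ι}
    (hj : IsGreedyChoice V U κ τ S j) : upperScore U κ τ S j < lowerScore V κ τ S j := by
  have hδ : 0 < upperStep n l κ := upperStep_pos hκ
  have hr := sqrt_div_lt_one hκ
  have hL := le_sum_lowerGain hV hS.low_isHermitian hS.low_posDef (hS.low_potential.trans_lt hr)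
  have hU := sum_upperGain_lt hU hS.up_isHermitian hδ hS.up_posDef
  -- The upper step is chosen so that both bounds on the totals are `1 - √(n/κ)`.
  have e : 1 / upperStep n l κ + √((l : ℝ) / κ) / upperStep n l κ = 1 - √((n : ℝ) / κ) := by
    have : 0 < 1 + √((l : ℝ) / κ) := by positivity
    have := sub_pos.2 hr
    rw [upperStep, ← add_div]
    field_simp
  have h1 := hS.low_potential
  have h2 := hS.up_potential
  by_contra! hle
  have : ∑ i, lowerScore V κ τ S i ≤ ∑ i, upperScore U κ τ S i :=
    Finset.sum_le_sum fun i _ => by linarith [hj i]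
  simp only [lowerScore, upperScore] at this
  linarith

variable [DecidableEq ι]

lemma sum_add_single_smul {M : Type*} [AddCommGroup M] [Module ℝ M] (w : ι → ℝ) (j : ι) (a : ℝ)
    (f : ι → M) : ∑ i, (w + Pi.single j a : ι → ℝ) i • f i = ∑ i, w i • f i + a • f j := by
  simp [add_smul, Finset.sum_add_distrib, Pi.single_apply, ite_smul]

lemma DualInvariant.dualUpdate [NeZero n] [NeZero l] (hV : V * Vᵀ = 1) (hU : U * Uᵀ = 1)
    (hκ : n < κ) {τ : ℕ} {S : DualState n l ι} (hS : DualInvariant V U κ τ S) {j : ι}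
    (hj : IsGreedyChoice V U κ τ S j) :
    DualInvariant V U κ (τ + 1) (dualUpdate V U κ τ S j) := by
  have hδ : 0 < upperStep n l κ := upperStep_pos hκ
  have hr := sqrt_div_lt_one hκ
  have hlt := upperScore_lt_lowerScore hV hU hκ hS hj
  have hU0 : 0 ≤ upperScore U κ τ S j := upperGain_nonneg hS.up_isHermitian hδ hS.up_posDef _
  set Δ : ℝ := 2 * (upperScore U κ τ S j + lowerScore V κ τ S j)⁻¹ with hΔdef
  have hΔ : 0 < Δ := mul_pos two_pos (inv_pos.2 (by linarith))
  -- `Δ⁻¹` is the mean of the two gains, hence lies strictly between them.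
  have hinv : Δ⁻¹ = (upperScore U κ τ S j + lowerScore V κ τ S j) / 2 := by
    rw [hΔdef, mul_inv, inv_inv]; ring
  obtain ⟨l1, l2⟩ := lower_barrier_step hS.low_isHermitian
    (posDef_sub_add_one_smul hS.low_isHermitian hS.low_posDef (hS.low_potential.trans_lt hr))
    (fun r => V r j) hΔ (by rw [hinv]; change _ ≤ lowerScore V κ τ S j; linarith)
  obtain ⟨u1, u2⟩ := upper_barrier_step hS.up_isHermitian hδ hS.up_posDef
    (fun r => U r j) hΔ (by rw [hinv]; change upperScore U κ τ S j < _; linarith)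
  refine ⟨isHermitian_add_smul_vecMulVec hS.low_isHermitian _ _, ?_, ?_,
    isHermitian_add_smul_vecMulVec hS.up_isHermitian _ _, ?_, ?_, ?_, ?_, ?_, ?_⟩
  · rw [lowerBarrier_succ]; exact l1
  · rw [lowerBarrier_succ]; exact l2.trans hS.low_potential
  · rw [upperBarrier_succ]; exact u1
  · rw [upperBarrier_succ]; exact u2.trans hS.up_potential
  · intro i
    refine add_nonneg (hS.weight_nonneg i) ?_
    rw [← hΔdef, Pi.single_apply]
    split_ifs
    exacts [hΔ.le, le_rfl]
  · simp only [ActuatorScheduling.dualUpdate, ← hΔdef]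
    rw [sum_add_single_smul, ← hS.low_eq]
  · simp only [ActuatorScheduling.dualUpdate, ← hΔdef]
    rw [sum_add_single_smul, ← hS.up_eq]
  · refine le_trans (Finset.card_le_card (t := insert j
      (Finset.univ.filter fun i => S.weight i ≠ 0)) fun i hi => ?_)
      ((Finset.card_insert_le _ _).trans (Nat.add_le_add_right hS.card_le 1))
    by_cases hij : i = j
    · simp [hij]
    · have := (Finset.mem_filter.1 hi).2
      simpa [hij, ActuatorScheduling.dualUpdate] using this

lemma dualInvariant_dualState [NeZero n] [NeZero l] (hV : V * Vᵀ = 1) (hU : U * Uᵀ = 1)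
    (hκ : n < κ) (j : ℕ → ι) {τ : ℕ}
    (hj : ∀ τ' < τ, IsGreedyChoice V U κ τ' (dualState V U κ j τ') (j τ')) :
    DualInvariant V U κ τ (dualState V U κ j τ) := by
  induction τ with
  | zero => exact dualInvariant_zero hκ
  | succ τ ih =>
    exact (ih fun τ' h => hj τ' (h.trans τ.lt_succ_self)).dualUpdate hV hU hκ (hj τ τ.lt_succ_self)

end DualSetAnalysis

/-! ### The weights returned by `DualSet*` -/

section Sparsification

variable {n : ℕ} {ι : Type} [Fintype ι] [DecidableEq ι] {V : Matrix (Fin n) ι ℝ} {κ : ℕ}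

/-- The output of `DualSet*(V, V, κ)` for an isotropic family: nonnegative weights, at most `κ` of
them nonzero, whose weighted sum of rank-one matrices lies between `(1 - √(n/κ))²` and
`(1 + √(n/κ))²`. -/
lemma dualSetStar_output_bounds [NeZero n] (hV : V * Vᵀ = 1) (hκ : n < κ) {c : ι → ℝ}
    (hc : IsDualSetStarOutput V V κ c) :
    (∀ i, 0 ≤ c i) ∧ (Finset.univ.filter fun i => c i ≠ 0).card ≤ κ ∧
    ((∑ i, c i • vecMulVec (fun r => V r i) (fun r => V r i))
      - ((1 - √((n : ℝ) / κ)) ^ 2) • (1 : Matrix (Fin n) (Fin n) ℝ)).PosSemidef ∧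
    (((1 + √((n : ℝ) / κ)) ^ 2) • (1 : Matrix (Fin n) (Fin n) ℝ)
      - ∑ i, c i • vecMulVec (fun r => V r i) (fun r => V r i)).PosSemidef := by
  obtain ⟨j, hj, rfl⟩ := hc
  have hS := dualInvariant_dualState hV hV hκ j (τ := κ) hj
  set S := dualState V V κ j κ
  have hr := sub_pos.2 (sqrt_div_lt_one hκ)
  have hκ0 : (0 : ℝ) < κ := by exact_mod_cast (Nat.zero_le n).trans_lt hκ
  set r := √((n : ℝ) / κ) with hrdef
  have hf : 0 < (κ : ℝ)⁻¹ * (1 - r) := by positivity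
  have hsqrt : √((κ : ℝ) * n) = κ * r := by
    rw [hrdef, show (κ : ℝ) * n = κ ^ 2 * (n / κ) by field_simp, Real.sqrt_mul (by positivity),
      Real.sqrt_sq hκ0.le]
  have hlow : ((κ : ℝ)⁻¹ * (1 - r)) * lowerBarrier n κ κ = (1 - r) ^ 2 := by
    rw [lowerBarrier, hsqrt]; field_simp
  have hup : ((κ : ℝ)⁻¹ * (1 - r)) * upperBarrier n n κ κ = (1 + r) ^ 2 := by
    rw [upperBarrier, upperStep, hsqrt, ← hrdef]; field_simp
  have hsum : ∑ i, (((κ : ℝ)⁻¹ * (1 - r)) • S.weight) i •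
        vecMulVec (fun r => V r i) (fun r => V r i)
      = ((κ : ℝ)⁻¹ * (1 - r)) • S.low := by
    rw [hS.low_eq, Finset.smul_sum]
    exact Finset.sum_congr rfl fun i _ => by rw [Pi.smul_apply, smul_eq_mul, mul_smul]
  refine ⟨fun i => mul_nonneg hf.le (hS.weight_nonneg i), ?_, ?_, ?_⟩
  · refine le_trans (Finset.card_le_card fun i hi => ?_) hS.card_le
    simp only [Finset.mem_filter, Finset.mem_univ, true_and] at hi ⊢
    exact fun h => hi (by simp [h])
  · rw [hsum, ← hlow, mul_smul _ (lowerBarrier n κ κ), ← smul_sub]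
    exact hS.low_posDef.posSemidef.smul hf.le
  · -- Both matrices of the algorithm coincide because `U = V`.
    rw [hsum, hS.low_eq, ← hS.up_eq, ← hup, mul_smul _ (upperBarrier n n κ κ), ← smul_sub]
    exact hS.up_posDef.posSemidef.smul hf.le

end Sparsification

/-! ### From weights to schedules -/

section Scheduling

open scoped MatrixOrder

variable {n m : ℕ} {A : Matrix (Fin n) (Fin n) ℝ} {B : Matrix (Fin n) (Fin m) ℝ} {t κ : ℕ}

lemma posDef_ctrbMatrix_mul_transpose (hAB : IsControllable A B) (hnt : n ≤ t) :
    (ctrbMatrix A B t * (ctrbMatrix A B t)ᵀ).PosDef := by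
  have h := PosDef.mul_conjTranspose_self (ctrbMatrix A B t) ?_
  · simpa using h
  have hrow : LinearIndependent ℝ (ctrbMatrix A B n).row := by
    rw [linearIndependent_iff_card_eq_finrank_span, Fintype.card_fin]
    rw [Set.finrank, ← rank_eq_finrank_span_row]; exact hAB.symm
  rw [← vecMul_injective_iff] at hrow
  intro x y hxy
  apply hrow
  ext q
  exact congrFun hxy (⟨q.1, q.1.2.trans_le hnt⟩, q.2)

lemma gramian_eq (A : Matrix (Fin n) (Fin n) ℝ) (B : Matrix (Fin n) (Fin m) ℝ) (t : ℕ) :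
    gramian A B t = ctrbMatrix A B t * (ctrbMatrix A B t)ᵀ := by
  rw [gramian, Finset.sum_range]
  ext a b
  rw [Matrix.sum_apply, mul_apply, Fintype.sum_prod_type]
  refine Finset.sum_congr rfl fun i _ => ?_
  rw [Matrix.mul_assoc _ Bᵀ, ← transpose_mul, mul_apply]
  rfl

/-- Reversing time matches the weight of the column `A^k b_i` with the scaling of actuator `i` at
time `t - 1 - k`; inactive actuators have weight zero, so the sum may run over all columns. -/
lemma scheduleGramian_eq (A : Matrix (Fin n) (Fin n) ℝ) (B : Matrix (Fin n) (Fin m) ℝ)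
    {c : Fin t × Fin m → ℝ} (hc : ∀ q, 0 ≤ c q) {e : ℝ} (he : 0 < e) :
    scheduleGramian A B (fun i k => √(c (Fin.rev k, i) / e))
      = e⁻¹ • ∑ q, c q • vecMulVec (fun r => ctrbMatrix A B t r q)
          (fun r => ctrbMatrix A B t r q) := by
  rw [scheduleGramian, Fintype.sum_prod_type, Finset.smul_sum, ← Equiv.sum_comp Fin.revPerm]
  refine Finset.sum_congr rfl fun k _ => ?_
  rw [activeSet, Finset.sum_filter, Finset.smul_sum]
  refine Finset.sum_congr rfl fun i _ => ?_
  have hk : t - ((Fin.rev k : Fin t) : ℕ) - 1 = k := by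
    rw [Fin.val_rev]; omega
  have h0 : 0 ≤ c (k, i) / e := div_nonneg (hc _) he.le
  simp only [Fin.revPerm_apply, Fin.rev_rev, hk]
  split_ifs with h
  · rw [Real.sq_sqrt h0, smul_smul, div_eq_inv_mul]; rfl
  · have : c (k, i) = 0 := by
      have := Real.sqrt_eq_zero'.1 (le_antisymm (not_lt.1 h) (Real.sqrt_nonneg _))
      rw [div_le_iff₀ he, zero_mul] at this
      exact le_antisymm this (hc _)
    simp [this]

lemma sum_smul_vecMulVec_columns {p q : ℕ} {ι : Type} [Fintype ι] (R : Matrix (Fin p) (Fin q) ℝ)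
    (V : Matrix (Fin q) ι ℝ) (c : ι → ℝ) :
    ∑ i, c i • vecMulVec (fun r => (R * V) r i) (fun r => (R * V) r i)
      = R * (∑ i, c i • vecMulVec (fun r => V r i) (fun r => V r i)) * Rᵀ := by
  rw [Matrix.mul_sum, Matrix.sum_mul]
  refine Finset.sum_congr rfl fun i _ => ?_
  rw [Matrix.mul_smul, Matrix.smul_mul, mul_vecMulVec, vecMulVec_mul, vecMul_transpose]
  rfl

lemma transpose_sqrt (W : Matrix (Fin n) (Fin n) ℝ) : (CFC.sqrt W)ᵀ = CFC.sqrt W := by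
  have : (CFC.sqrt W).PosSemidef := nonneg_iff_posSemidef.1 (CFC.sqrt_nonneg W)
  simpa using this.isHermitian.eq

lemma isUnit_det_sqrt {W : Matrix (Fin n) (Fin n) ℝ} (hW : W.PosDef) :
    IsUnit (CFC.sqrt W).det := by
  have h : CFC.sqrt W * CFC.sqrt W = W :=
    CFC.sqrt_mul_sqrt_self W (nonneg_iff_posSemidef.2 hW.posSemidef)
  have hd : IsUnit W.det := (Matrix.isUnit_iff_isUnit_det _).1 hW.isUnit
  rw [← h, det_mul] at hd
  exact isUnit_of_mul_isUnit_left hd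

lemma whitenedCtrb_mul_transpose
    (hW : (ctrbMatrix A B t * (ctrbMatrix A B t)ᵀ).PosDef) :
    whitenedCtrb A B t * (whitenedCtrb A B t)ᵀ = 1 := by
  have hd := isUnit_det_sqrt hW
  have h : CFC.sqrt (ctrbMatrix A B t * (ctrbMatrix A B t)ᵀ)
      * CFC.sqrt (ctrbMatrix A B t * (ctrbMatrix A B t)ᵀ)
        = ctrbMatrix A B t * (ctrbMatrix A B t)ᵀ :=
    CFC.sqrt_mul_sqrt_self _ (nonneg_iff_posSemidef.2 hW.posSemidef)
  have hT := transpose_sqrt (ctrbMatrix A B t * (ctrbMatrix A B t)ᵀ)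
  rw [whitenedCtrb, invSqrt, transpose_mul, Matrix.mul_assoc, ← Matrix.mul_assoc (ctrbMatrix A B t),
    transpose_nonsing_inv, hT]
  set S := CFC.sqrt (ctrbMatrix A B t * (ctrbMatrix A B t)ᵀ)
  rw [← h, Matrix.mul_assoc, mul_nonsing_inv _ hd, mul_one, nonsing_inv_mul _ hd]

lemma sqrt_mul_whitenedCtrb (hW : (ctrbMatrix A B t * (ctrbMatrix A B t)ᵀ).PosDef) :
    CFC.sqrt (ctrbMatrix A B t * (ctrbMatrix A B t)ᵀ) * whitenedCtrb A B t = ctrbMatrix A B t := by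
  rw [whitenedCtrb, invSqrt, ← Matrix.mul_assoc, mul_nonsing_inv _ (isUnit_det_sqrt hW),
    Matrix.one_mul]

lemma two_div_sqrt_add_sqrt {a b : ℝ} (ha : 0 < a) (hb : 0 < b) :
    2 / (√(b / a) + √(a / b)) = 2 * √(a / b) / (1 + a / b) := by
  have h1 : √(b / a) = (√(a / b))⁻¹ := by rw [← Real.sqrt_inv, inv_div]
  have h2 : 0 < √(a / b) := Real.sqrt_pos.2 (by positivity)
  have h3 : a / b = √(a / b) ^ 2 := (Real.sq_sqrt (by positivity)).symm
  rw [h1]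
  conv_rhs => rw [h3]
  rw [Real.sqrt_sq h2.le]
  field_simp

lemma IsAlgorithmOutput.isApproximation {d : ℝ} (hn : 0 < n) (hnt : n ≤ t) (hd : 1 < d)
    (hκ : (κ : ℝ) = d * t) (hAB : IsControllable A B) {s : Fin m → Fin t → ℝ}
    (hs : IsAlgorithmOutput A B t κ s) :
    IsApproximation A B t (2 / (√(d * t / n) + √(n / (d * t)))) d s := by
  have : NeZero n := ⟨hn.ne'⟩
  have hn0 : (0 : ℝ) < n := by exact_mod_cast hn
  have ht0 : (0 : ℝ) < t := by exact_mod_cast hn.trans_le hnt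
  have hnt' : (n : ℝ) ≤ t := by exact_mod_cast hnt
  have hnκ' : (n : ℝ) < κ := by rw [hκ]; nlinarith
  have hnκ : n < κ := by exact_mod_cast hnκ'
  have hκ0 : (0 : ℝ) < κ := hn0.trans hnκ'
  have hW := posDef_ctrbMatrix_mul_transpose hAB hnt
  obtain ⟨c, hc, rfl⟩ := hs
  obtain ⟨hc0, hcard, hlow, hup⟩ := dualSetStar_output_bounds (whitenedCtrb_mul_transpose hW) hnκ hc
  rw [← hκ, two_div_sqrt_add_sqrt hn0 hκ0]
  have hrlt := sqrt_div_lt_one hnκ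
  have hr0 : 0 < √((n : ℝ) / κ) := Real.sqrt_pos.2 (by positivity)
  have hrsq : (n : ℝ) / κ = √((n : ℝ) / κ) ^ 2 := (Real.sq_sqrt (by positivity)).symm
  have hepos : 0 < 1 + (n : ℝ) / κ := by positivity
  set e := 1 + (n : ℝ) / κ with he
  set r := √((n : ℝ) / κ) with hr
  have hsched : scheduleGramian A B (fun i k => √(c (Fin.rev k, i) / e))
      = CFC.sqrt (ctrbMatrix A B t * (ctrbMatrix A B t)ᵀ)
        * (e⁻¹ • ∑ q, c q • vecMulVec (fun r => whitenedCtrb A B t r q)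
          (fun r => whitenedCtrb A B t r q))
        * (CFC.sqrt (ctrbMatrix A B t * (ctrbMatrix A B t)ᵀ))ᵀ := by
    rw [scheduleGramian_eq A B hc0 hepos, Matrix.mul_smul, Matrix.smul_mul,
      ← sum_smul_vecMulVec_columns, sqrt_mul_whitenedCtrb hW]
  have hgram : ∀ x : ℝ, x • gramian A B t = CFC.sqrt (ctrbMatrix A B t * (ctrbMatrix A B t)ᵀ)
        * (x • (1 : Matrix (Fin n) (Fin n) ℝ))
        * (CFC.sqrt (ctrbMatrix A B t * (ctrbMatrix A B t)ᵀ))ᵀ := by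
    intro x
    rw [transpose_sqrt, Matrix.mul_smul, mul_one, Matrix.smul_mul,
      CFC.sqrt_mul_sqrt_self _ (nonneg_iff_posSemidef.2 hW.posSemidef), gramian_eq]
  refine ⟨fun i k => Real.sqrt_nonneg _, by positivity, ?_, ?_, ?_, ?_⟩
  · rw [div_lt_one hepos, he, hrsq]
    nlinarith [sq_pos_of_pos (sub_pos.2 hrlt)]
  · rw [div_le_iff₀ ht0, ← hκ]
    refine le_trans ?_ (Nat.cast_le.2 hcard)
    rw [← Nat.cast_sum, Nat.cast_le, ← Finset.card_sigma]
    refine Finset.card_le_card_of_injOn (fun p => (Fin.rev p.1, p.2)) (fun p hp => ?_) ?_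
    · simp only [activeSet, Finset.coe_sigma, Set.mem_sigma_iff, Finset.coe_filter,
        Finset.mem_univ, true_and, Set.mem_ofPred_eq, Real.sqrt_pos] at hp ⊢
      exact fun h => by simp [h] at hp
    · rintro ⟨k, i⟩ _ ⟨k', i'⟩ _ h
      simpa using h
  · have h1 : 1 - 2 * r / e = e⁻¹ * (1 - r) ^ 2 := by
      have : e = 1 + r ^ 2 := by rw [he, hrsq]
      field_simp; rw [this]; ring
    rw [hsched, hgram, ← sub_mul, ← mul_sub, h1, mul_smul, ← smul_sub]
    simpa using (hlow.smul (inv_pos.2 hepos).le).mul_mul_conjTranspose_same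
      (CFC.sqrt (ctrbMatrix A B t * (ctrbMatrix A B t)ᵀ))
  · have h1 : 1 + 2 * r / e = e⁻¹ * (1 + r) ^ 2 := by
      have : e = 1 + r ^ 2 := by rw [he, hrsq]
      field_simp; rw [this]; ring
    rw [hsched, hgram, ← sub_mul, ← mul_sub, h1, mul_smul, ← smul_sub]
    simpa using (hup.smul (inv_pos.2 hepos).le).mul_mul_conjTranspose_same
      (CFC.sqrt (ctrbMatrix A B t * (ctrbMatrix A B t)ᵀ))

end Scheduling

/-! ### Values and costs of the elementary programs -/

namespace Counted

variable {α β σ : Type}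

@[simp] lemma pure_val (a : α) : (pure a : Counted α).val = a := rfl

@[simp] lemma pure_ops (a : α) : (pure a : Counted α).ops = 0 := rfl

lemma bind_val (x : Counted α) (f : α → Counted β) : (x >>= f).val = (f x.val).val := rfl

lemma bind_ops_le {x : Counted α} {f : α → Counted β} {a b : ℕ} (hx : x.ops ≤ a)
    (hf : ∀ v, (f v).ops ≤ b) : (x >>= f).ops ≤ a + b :=
  add_le_add hx (hf _)

lemma loop_append_val (L L' : List α) (step : α → σ → Counted σ) (s : σ) :
    (loop (L ++ L') step s).val = (loop L' step (loop L step s).val).val := by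
  induction L generalizing s with
  | nil => rfl
  | cons a L ih => exact ih _

lemma loop_singleton_val (a : α) (step : α → σ → Counted σ) (s : σ) :
    (loop [a] step s).val = (step a s).val := rfl

lemma loop_map_val (L : List β) (g : β → α) (step : α → σ → Counted σ) (s : σ) :
    (loop (L.map g) step s).val = (loop L (fun b => step (g b)) s).val := by
  induction L generalizing s with
  | nil => rfl
  | cons a L ih => exact ih _

/-- An invariant of a loop over `0, …, n - 1`. -/
lemma loop_finRange_induction {n : ℕ} {step : Fin n → σ → Counted σ} {P : ℕ → σ → Prop} {s : σ}
    (h0 : P 0 s) (h : ∀ (k : Fin n) (s : σ), P k s → P (k + 1) (step k s).val) :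
    P n (loop (List.finRange n) step s).val := by
  induction n with
  | zero => simpa [loop] using h0
  | succ n ih =>
    rw [List.finRange_succ_last, loop_append_val, loop_map_val]
    exact h (Fin.last n) _ (ih fun k s hs => h k.castSucc s hs)

lemma loop_ops_le {L : List α} {step : α → σ → Counted σ} {c : ℕ}
    (h : ∀ a s, (step a s).ops ≤ c) (s : σ) : (loop L step s).ops ≤ L.length * c := by
  induction L generalizing s with
  | nil => simp [loop]
  | cons a L ih =>
    rw [List.length_cons, add_mul, one_mul, add_comm]
    exact bind_ops_le (h a s) fun s' => ih s'

lemma tabulate_ops_le {ι : Type} [Fintype ι] {f : ι → Counted α} {c : ℕ}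
    (h : ∀ i, (f i).ops ≤ c) : (tabulate f).ops ≤ Fintype.card ι * c := by
  simpa [tabulate] using Finset.sum_le_card_nsmul Finset.univ (fun i => (f i).ops) c fun i _ => h i

lemma sum_ops_le {ι : Type} [Fintype ι] {f : ι → Counted ℝ} {c : ℕ}
    (h : ∀ i, (f i).ops ≤ c) : (sum f).ops ≤ Fintype.card ι * (c + 1) := by
  simpa only [sum, smul_eq_mul, Finset.card_univ] using
    Finset.sum_le_card_nsmul Finset.univ (fun i => (f i).ops + 1) (c + 1)
    fun i _ => Nat.add_le_add_right (h i) 1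

lemma tabulateMatrix_ops_le {ι κ : Type} [Fintype ι] [Fintype κ] {f : ι → κ → Counted ℝ} {c : ℕ}
    (h : ∀ i j, (f i j).ops ≤ c) :
    (tabulateMatrix f).ops ≤ Fintype.card ι * (Fintype.card κ * c) :=
  tabulate_ops_le (f := fun i => tabulate (f i)) fun i => tabulate_ops_le (h i)

lemma dot_ops_le {ι : Type} [Fintype ι] (v w : ι → ℝ) : (dot v w).ops ≤ Fintype.card ι * 2 :=
  sum_ops_le (c := 1) fun _ => le_rfl

lemma mulVec_ops_le {ι κ : Type} [Fintype ι] [Fintype κ] (M : Matrix ι κ ℝ) (v : κ → ℝ) :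
    (mulVec M v).ops ≤ Fintype.card ι * (Fintype.card κ * 2) :=
  tabulate_ops_le fun _ => dot_ops_le _ _

lemma matMul_ops_le {ι κ μ : Type} [Fintype ι] [Fintype κ] [Fintype μ]
    (M : Matrix ι κ ℝ) (N : Matrix κ μ ℝ) :
    (matMul M N).ops ≤ Fintype.card ι * (Fintype.card μ * (Fintype.card κ * 2)) :=
  tabulateMatrix_ops_le fun _ _ => dot_ops_le _ _

lemma trace_ops_le {n : ℕ} (M : Matrix (Fin n) (Fin n) ℝ) : (trace M).ops ≤ n := by
  simpa [trace] using sum_ops_le (f := fun i => (pure (M i i) : Counted ℝ)) (c := 0) fun _ => le_rfl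

lemma subScalar_ops_le {n : ℕ} (M : Matrix (Fin n) (Fin n) ℝ) (x : ℝ) :
    (subScalar M x).ops ≤ n * n := by
  have : (subScalar M x).ops ≤ Fintype.card (Fin n) * (Fintype.card (Fin n) * 1) :=
    tabulateMatrix_ops_le fun i j => by split_ifs; exacts [le_rfl, Nat.zero_le _]
  simpa using this

lemma scalarSub_ops_le {n : ℕ} (x : ℝ) (M : Matrix (Fin n) (Fin n) ℝ) :
    (scalarSub x M).ops ≤ n * n := by
  have : (scalarSub x M).ops ≤ Fintype.card (Fin n) * (Fintype.card (Fin n) * 1) :=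
    tabulateMatrix_ops_le fun i j => by split_ifs; exacts [le_rfl, le_rfl]
  simpa using this

lemma addRankOne_ops_le {n : ℕ} (M : Matrix (Fin n) (Fin n) ℝ) (x : ℝ) (v : Fin n → ℝ) :
    (addRankOne M x v).ops ≤ n * (n * 3) := by
  have : (addRankOne M x v).ops ≤ Fintype.card (Fin n) * (Fintype.card (Fin n) * 3) :=
    tabulateMatrix_ops_le fun i j => le_rfl
  simpa using this

lemma gaussJordanStep_ops_le {n : ℕ} (M : Matrix (Fin n) (Fin n) ℝ) (k : Fin n)
    (X : Matrix (Fin n) (Fin n) ℝ) :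
    (gaussJordanStep M k X).ops ≤ n * (n * 2) + (n * 1 + n * (n * 2)) := by
  refine bind_ops_le (by simpa using mulVec_ops_le X _) fun w => bind_ops_le
    (by simpa using tabulate_ops_le (f := fun j => div (X k j) (w k)) (c := 1) fun _ => le_rfl)
    fun p => ?_
  refine (tabulateMatrix_ops_le (c := 2) fun i j => ?_).trans (by simp)
  split_ifs
  exacts [Nat.zero_le _, le_rfl]

lemma inverse_ops_le {n : ℕ} (M : Matrix (Fin n) (Fin n) ℝ) :
    (inverse M).ops ≤ n * (n * (n * 2) + (n * 1 + n * (n * 2))) := by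
  simpa [inverse] using loop_ops_le (L := List.finRange n) (gaussJordanStep_ops_le M) 1

lemma subScalar_val {n : ℕ} (M : Matrix (Fin n) (Fin n) ℝ) (x : ℝ) :
    (subScalar M x).val = M - x • (1 : Matrix (Fin n) (Fin n) ℝ) := by
  ext i j
  by_cases h : i = j <;> simp [subScalar, tabulateMatrix, sub, h]

lemma scalarSub_val {n : ℕ} (x : ℝ) (M : Matrix (Fin n) (Fin n) ℝ) :
    (scalarSub x M).val = x • (1 : Matrix (Fin n) (Fin n) ℝ) - M := by
  ext i j
  by_cases h : i = j <;> simp [scalarSub, tabulateMatrix, sub, h]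

/-! ### Gauss–Jordan elimination on positive definite matrices -/

section GaussJordan

variable {n : ℕ} {M : Matrix (Fin n) (Fin n) ℝ}

lemma gaussJordanStep_apply (M : Matrix (Fin n) (Fin n) ℝ) (k : Fin n)
    (X : Matrix (Fin n) (Fin n) ℝ) (i j : Fin n) :
    (gaussJordanStep M k X).val i j = if i = k then X k j / (X * M) k k
      else X i j - (X * M) i k * (X k j / (X * M) k k) := by
  change (if i = k then pure (X k j / (X * M) k k) else
    (⟨X i j - (X * M) i k * (X k j / (X * M) k k), 1 + 1⟩ : Counted ℝ)).val = _
  split_ifs <;> rfl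

lemma gaussJordanStep_mulVec (M : Matrix (Fin n) (Fin n) ℝ) (k : Fin n)
    (X : Matrix (Fin n) (Fin n) ℝ) (v : Fin n → ℝ) (i : Fin n) :
    ((gaussJordanStep M k X).val *ᵥ v) i = if i = k then (X *ᵥ v) k / (X * M) k k
      else (X *ᵥ v) i - (X * M) i k * ((X *ᵥ v) k / (X * M) k k) := by
  simp only [Matrix.mulVec, dotProduct, gaussJordanStep_apply]
  split_ifs
  · rw [Finset.sum_div]
    exact Finset.sum_congr rfl fun j _ => by ring
  · rw [Finset.sum_div, Finset.mul_sum, ← Finset.sum_sub_distrib]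
    exact Finset.sum_congr rfl fun j _ => by ring

/-- The state of Gauss–Jordan elimination before column `k` is treated: `X` has already turned the
first `k` columns of `M` into unit vectors, has not touched the coordinates from `k` on, and is
injective. -/
structure IsPartialInverse (M : Matrix (Fin n) (Fin n) ℝ) (k : ℕ)
    (X : Matrix (Fin n) (Fin n) ℝ) : Prop where
  left : ∀ i j : Fin n, (j : ℕ) < k → (X * M) i j = if i = j then 1 else 0
  right : ∀ i j : Fin n, k ≤ (j : ℕ) → X i j = if i = j then 1 else 0
  injective : ∀ v, X *ᵥ v = 0 → v = 0

/-- The pivot is the value `zᵀ M z` at a vector with `z_k = 1`, so it is positive. -/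
lemma IsPartialInverse.pivot_pos (hM : M.PosDef) {k : Fin n} {X : Matrix (Fin n) (Fin n) ℝ}
    (hX : IsPartialInverse M k X) : 0 < (X * M) k k := by
  let w : Fin n → ℝ := fun i => (X * M) i k
  -- `z` corrects the `k`-th unit vector so that `X M z` vanishes in the coordinates before `k`.
  let z : Fin n → ℝ := fun j => (if j < k then -w j else 0) + if j = k then 1 else 0
  let r : Fin n → ℝ := fun i => if i < k then 0 else w i
  have h1 : (X * M) *ᵥ z = r := by
    ext i
    have : ∀ j, (X * M) i j * z j
        = (if i = j then (if j < k then -w j else 0) else 0) + if j = k then w i else 0 := by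
      intro j
      rcases lt_trichotomy j k with h | h | h
      · simp only [z, hX.left i j h, h, h.ne, if_true, if_false, add_zero]
        split_ifs <;> simp
      · subst h; simp [z, w]
      · simp [z, h.not_gt, h.ne']
    simp only [Matrix.mulVec, dotProduct, this, Finset.sum_add_distrib, Finset.sum_ite_eq,
      Finset.sum_ite_eq', Finset.mem_univ, if_true, r]
    split_ifs <;> ring
  have h2 : X *ᵥ r = r := by
    ext i
    have : ∀ j, X i j * r j = if i = j then r j else 0 := by
      intro j
      by_cases h : j < k
      · simp [r, h]
      · rw [hX.right i j (not_lt.1 h)]; simp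
    simp [Matrix.mulVec, dotProduct, this]
  have h3 : M *ᵥ z = r := by
    rw [← sub_eq_zero]
    apply hX.injective
    rw [mulVec_sub, mulVec_mulVec, h1, h2, sub_self]
  have hz : z ≠ 0 := fun h => by simpa [z] using congrFun h k
  have h4 := hM.dotProduct_mulVec_pos hz
  rw [star_trivial, h3] at h4
  have h5 : ∀ i, z i * r i = if i = k then w k else 0 := by
    intro i
    rcases lt_trichotomy i k with h | h | h
    · simp [r, h, h.ne]
    · subst h; simp [z, r]
    · simp [z, h.not_gt, h.ne']
  simpa [dotProduct, h5] using h4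

lemma IsPartialInverse.step (hM : M.PosDef) {k : Fin n} {X : Matrix (Fin n) (Fin n) ℝ}
    (hX : IsPartialInverse M k X) : IsPartialInverse M (k + 1) (gaussJordanStep M k X).val := by
  have hp := (hX.pivot_pos hM).ne'
  refine ⟨fun i j hj => ?_, fun i j hj => ?_, fun v hv => hX.injective v ?_⟩
  · change ((gaussJordanStep M k X).val *ᵥ fun r => M r j) i = _
    rw [gaussJordanStep_mulVec]
    change (if i = k then (X * M) k j / (X * M) k k
      else (X * M) i j - (X * M) i k * ((X * M) k j / (X * M) k k)) = _
    rcases Nat.lt_succ_iff_lt_or_eq.1 hj with h | h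
    · have hkj : k ≠ j := fun e => by simp [e] at h
      simp only [hX.left _ j h, hkj, if_false]
      split_ifs with h1 h2 <;> simp_all
    · obtain rfl : j = k := Fin.ext h
      split_ifs <;> simp [hp]
  · have hkj : k ≠ j := fun e => by simp [e] at hj
    rw [gaussJordanStep_apply, hX.right _ j (by omega), hX.right _ j (by omega)]
    split_ifs <;> simp_all
  · have h1 : (X *ᵥ v) k = 0 := by
      have := congrFun hv k
      rw [gaussJordanStep_mulVec, if_pos rfl] at this
      simpa [hp] using this
    ext i
    by_cases h : i = k
    · rw [h, h1]; rfl
    · have := congrFun hv i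
      rw [gaussJordanStep_mulVec, if_neg h, h1] at this
      simpa using this

lemma inverse_val (hM : M.PosDef) : (inverse M).val = M⁻¹ := by
  have h0 : IsPartialInverse M 0 (1 : Matrix (Fin n) (Fin n) ℝ) :=
    ⟨fun _ _ h => absurd h (Nat.not_lt_zero _), fun i j _ => one_apply,
      fun v hv => by rwa [one_mulVec] at hv⟩
  have h := loop_finRange_induction (P := IsPartialInverse M) h0 fun k X hX => hX.step hM
  symm
  apply Matrix.inv_eq_left_inv
  ext i j
  rw [one_apply]
  exact h.left i j j.2

end GaussJordan

end Counted

open Counted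

/-! ### The program makes greedy choices -/

section Correctness

variable {n l m : ℕ} {ι : Type}

/-- The search loop of an iteration of `DualSet*`: the first maximizer of `low - up` along a list,
together with the maximum. -/
noncomputable def argmaxScan (low up : ι → ℝ) (L : List ι) (b : Option (ι × ℝ)) :
    Counted (Option (ι × ℝ)) :=
  loop L (fun i (b : Option (ι × ℝ)) => do
    let g ← sub (low i) (up i)
    match b with
    | none => pure (some (i, g))
    | some jh => do
      let better ← lt jh.2 g
      pure (if better then some (i, g) else b)) b

lemma argmaxScan_ops_le (low up : ι → ℝ) (L : List ι) (b : Option (ι × ℝ)) :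
    (argmaxScan low up L b).ops ≤ L.length * 2 := by
  refine loop_ops_le (fun i b => ?_) b
  cases b
  exacts [Nat.le_succ 1, le_rfl]

lemma argmaxScan_cons_some (low up : ι → ℝ) (i : ι) (L : List ι) (jh : ι × ℝ) :
    (argmaxScan low up (i :: L) (some jh)).val
      = (argmaxScan low up L
          (some (if jh.2 < low i - up i then (i, low i - up i) else jh))).val := by
  have : (if @decide (jh.2 < low i - up i) (Classical.propDecidable _)
      then some (i, low i - up i) else some jh)
      = some (if jh.2 < low i - up i then (i, low i - up i) else jh) := by
    by_cases h : jh.2 < low i - up i <;> simp [h]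
  rw [← this]
  rfl

lemma argmaxScan_some (low up : ι → ℝ) (L : List ι) (i₀ : ι) :
    ∃ j, (argmaxScan low up L (some (i₀, low i₀ - up i₀))).val = some (j, low j - up j) ∧
      low i₀ - up i₀ ≤ low j - up j ∧ ∀ i ∈ L, low i - up i ≤ low j - up j := by
  induction L generalizing i₀ with
  | nil => exact ⟨i₀, rfl, le_rfl, by simp⟩
  | cons i L ih =>
    rw [argmaxScan_cons_some]
    by_cases h : low i₀ - up i₀ < low i - up i
    · rw [if_pos h]
      obtain ⟨j, h1, h2, h3⟩ := ih i
      exact ⟨j, h1, h.le.trans h2, List.forall_mem_cons.2 ⟨h2, h3⟩⟩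
    · rw [if_neg h]
      obtain ⟨j, h1, h2, h3⟩ := ih i₀
      exact ⟨j, h1, h2, List.forall_mem_cons.2 ⟨(not_lt.1 h).trans h2, h3⟩⟩

lemma argmaxScan_none (low up : ι → ℝ) {L : List ι} (hL : L ≠ []) :
    ∃ j, (argmaxScan low up L none).val = some (j, low j - up j) ∧
      ∀ i ∈ L, low i - up i ≤ low j - up j := by
  cases L with
  | nil => exact absurd rfl hL
  | cons i L =>
    obtain ⟨j, h1, h2, h3⟩ := argmaxScan_some low up L i
    exact ⟨j, h1, List.forall_mem_cons.2 ⟨h2, h3⟩⟩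

/-- The end of an iteration of `DualSet*`, once both scores of all indices are known. -/
noncomputable def greedyUpdate [DecidableEq ι] (enum : List ι)
    (V : Matrix (Fin n) ι ℝ) (U : Matrix (Fin l) ι ℝ) (S : DualState n l ι) (low up : ι → ℝ) :
    Counted (DualState n l ι) := do
  let best ← argmaxScan low up enum none
  match best with
  | none => pure S
  | some jh => do
    let z ← add (up jh.1) (low jh.1)
    let Δ ← div 2 z
    let c ← add (S.weight jh.1) Δ
    let low' ← addRankOne S.low Δ fun r => V r jh.1
    let up' ← addRankOne S.up Δ fun r => U r jh.1
    pure ⟨Function.update S.weight jh.1 c, low', up'⟩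

lemma greedyUpdate_val [DecidableEq ι] {enum : List ι} (henum : ∀ i, i ∈ enum)
    (hne : enum ≠ []) (V : Matrix (Fin n) ι ℝ) (U : Matrix (Fin l) ι ℝ) (κ τ : ℕ)
    (S : DualState n l ι) :
    ∃ j, IsGreedyChoice V U κ τ S j ∧
      (greedyUpdate enum V U S (lowerScore V κ τ S) (upperScore U κ τ S)).val
        = dualUpdate V U κ τ S j := by
  obtain ⟨j, h1, h2⟩ := argmaxScan_none (lowerScore V κ τ S) (upperScore U κ τ S) hne
  refine ⟨j, fun i => h2 i (henum i), ?_⟩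
  rw [greedyUpdate, bind_val, h1]
  have hΔ : 2 / (upperScore U κ τ S j + lowerScore V κ τ S j)
      = 2 * (upperScore U κ τ S j + lowerScore V κ τ S j)⁻¹ := div_eq_mul_inv _ _
  simp only [dualUpdate, ← hΔ]
  change DualState.mk (Function.update S.weight j (S.weight j +
    2 / (upperScore U κ τ S j + lowerScore V κ τ S j))) _ _ = _
  congr 1
  ext i
  by_cases h : i = j
  · subst h; simp
  · simp [h]

variable [DecidableEq ι]

lemma dualState_congr (V : Matrix (Fin n) ι ℝ) (U : Matrix (Fin l) ι ℝ) (κ : ℕ) {j j' : ℕ → ι}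
    {τ : ℕ} (h : ∀ τ' < τ, j τ' = j' τ') : dualState V U κ j τ = dualState V U κ j' τ := by
  induction τ with
  | zero => rfl
  | succ τ ih =>
    rw [dualState, dualState, ih fun τ' h' => h τ' (h'.trans τ.lt_succ_self),
      h τ τ.lt_succ_self]

variable [Fintype ι]

lemma dualIteration_val {enum : List ι} {V : Matrix (Fin n) ι ℝ} {U : Matrix (Fin l) ι ℝ}
    [NeZero n] [NeZero l] {κ τ : ℕ} (hκ : n < κ) {S : DualState n l ι}
    (hS : DualInvariant V U κ τ S) :
    (dualIteration enum V U (upperStep n l κ) (√((κ : ℝ) * n)) (√((κ : ℝ) * l)) τ S).val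
      = (greedyUpdate enum V U S (lowerScore V κ τ S) (upperScore U κ τ S)).val := by
  have hδ : 0 < upperStep n l κ := upperStep_pos hκ
  have hlow' := posDef_sub_add_one_smul hS.low_isHermitian hS.low_posDef
    (hS.low_potential.trans_lt (sqrt_div_lt_one hκ))
  have hup' := posDef_add_smul_sub hS.up_isHermitian hδ hS.up_posDef
  set μ := lowerBarrier n κ τ with hμ
  set ν := upperBarrier n l κ τ with hν
  have eP : (Counted.inverse (subScalar S.low μ).val).val
      = (S.low - μ • (1 : Matrix (Fin n) (Fin n) ℝ))⁻¹ := by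
    rw [subScalar_val, inverse_val hS.low_posDef]
  have eP' : (Counted.inverse (subScalar S.low (μ + 1)).val).val
      = (S.low - (μ + 1) • (1 : Matrix (Fin n) (Fin n) ℝ))⁻¹ := by
    rw [subScalar_val, inverse_val hlow']
  have eQ : (Counted.inverse (scalarSub ν S.up).val).val
      = (ν • (1 : Matrix (Fin l) (Fin l) ℝ) - S.up)⁻¹ := by
    rw [scalarSub_val, inverse_val hS.up_posDef]
  have eQ' : (Counted.inverse (scalarSub (ν + upperStep n l κ) S.up).val).val
      = ((ν + upperStep n l κ) • (1 : Matrix (Fin l) (Fin l) ℝ) - S.up)⁻¹ := by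
    rw [scalarSub_val, inverse_val hup']
  have hL : (fun i => (fun r => V r i) ⬝ᵥ
        ((Counted.inverse (subScalar S.low (μ + 1)).val).val *ᵥ
          ((Counted.inverse (subScalar S.low (μ + 1)).val).val *ᵥ fun r => V r i))
        / ((Counted.inverse (subScalar S.low (μ + 1)).val).val.trace
          - (Counted.inverse (subScalar S.low μ).val).val.trace)
      - (fun r => V r i) ⬝ᵥ
        ((Counted.inverse (subScalar S.low (μ + 1)).val).val *ᵥ fun r => V r i))
      = lowerScore V κ τ S := by
    ext i
    rw [eP, eP', trace_inv_sub_smul_one hS.low_isHermitian hS.low_posDef,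
      trace_inv_sub_smul_one hS.low_isHermitian hlow', mulVec_mulVec, ← pow_two]
    rfl
  have hU : (fun i => (fun r => U r i) ⬝ᵥ
        ((Counted.inverse (scalarSub (ν + upperStep n l κ) S.up).val).val *ᵥ
          ((Counted.inverse (scalarSub (ν + upperStep n l κ) S.up).val).val *ᵥ fun r => U r i))
        / ((Counted.inverse (scalarSub ν S.up).val).val.trace
          - (Counted.inverse (scalarSub (ν + upperStep n l κ) S.up).val).val.trace)
      + (fun r => U r i) ⬝ᵥ
        ((Counted.inverse (scalarSub (ν + upperStep n l κ) S.up).val).val *ᵥ fun r => U r i))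
      = upperScore U κ τ S := by
    ext i
    rw [eQ, eQ', trace_inv_smul_one_sub hS.up_isHermitian hS.up_posDef,
      trace_inv_smul_one_sub hS.up_isHermitian hup', mulVec_mulVec, ← pow_two]
    rfl
  -- With the scores in the form in which the program computes them, both sides agree by definition.
  rw [← hL, ← hU]
  rfl

/-- The loop of `DualSet*` runs through the states of a sequence of greedy choices. -/
lemma exists_greedy_dualState_eq_loop {enum : List ι} (henum : ∀ i, i ∈ enum) (hne : enum ≠ [])
    {V : Matrix (Fin n) ι ℝ} {U : Matrix (Fin l) ι ℝ} [NeZero n] [NeZero l] {κ : ℕ} (hκ : n < κ)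
    (hV : V * Vᵀ = 1) (hU : U * Uᵀ = 1) (τ : ℕ) :
    ∃ j : ℕ → ι, (∀ τ' < τ, IsGreedyChoice V U κ τ' (dualState V U κ j τ') (j τ')) ∧
      (loop (List.range τ) (dualIteration enum V U (upperStep n l κ) (√((κ : ℝ) * n))
        (√((κ : ℝ) * l))) ⟨0, 0, 0⟩).val = dualState V U κ j τ := by
  induction τ with
  | zero =>
    obtain ⟨i, -⟩ := List.exists_mem_of_ne_nil _ hne
    exact ⟨fun _ => i, by simp, rfl⟩
  | succ τ ih =>
    obtain ⟨j, hj, hval⟩ := ih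
    obtain ⟨i, hi, hi'⟩ := greedyUpdate_val henum hne V U κ τ (dualState V U κ j τ)
    have hagree : ∀ τ' ≤ τ,
        dualState V U κ (Function.update j τ i) τ' = dualState V U κ j τ' := fun τ' h' =>
      dualState_congr V U κ fun τ'' h'' => Function.update_of_ne (by omega) _ _
    -- Redefining the choice at `τ` leaves the states up to `τ` unchanged.
    refine ⟨Function.update j τ i, fun τ' h' => ?_, ?_⟩
    · rw [hagree τ' (by omega)]
      rcases Nat.lt_succ_iff_lt_or_eq.1 h' with h | rfl
      · rw [Function.update_of_ne h.ne]; exact hj τ' h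
      · rw [Function.update_self]; exact hi
    · rw [List.range_succ, loop_append_val, hval, loop_singleton_val, dualState,
        hagree τ le_rfl, Function.update_self, ← hi']
      exact dualIteration_val hκ (dualInvariant_dualState hV hU hκ j hj)

lemma dualSetStar_val {enum : List ι} (henum : ∀ i, i ∈ enum) (hne : enum ≠ [])
    {V : Matrix (Fin n) ι ℝ} {U : Matrix (Fin l) ι ℝ} [NeZero n] [NeZero l] {κ : ℕ} (hκ : n < κ)
    (hV : V * Vᵀ = 1) (hU : U * Uᵀ = 1) :
    IsDualSetStarOutput V U κ (dualSetStar enum V U κ).val := by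
  obtain ⟨j, hj, hval⟩ := exists_greedy_dualState_eq_loop henum hne hκ hV hU κ
  refine ⟨j, hj, ?_⟩
  rw [← hval]
  ext i
  rw [Pi.smul_apply, smul_eq_mul, inv_mul_eq_div]
  rfl

lemma ctrbProgram_val (A : Matrix (Fin n) (Fin n) ℝ) (B : Matrix (Fin n) (Fin m) ℝ) (t : ℕ) :
    (ctrbProgram A B t).val = ctrbMatrix A B t := by
  have h := loop_finRange_induction (n := t)
    (step := fun k (S : Matrix (Fin n) (Fin m) ℝ × (Fin t → Matrix (Fin n) (Fin m) ℝ)) => do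
      let next ← matMul A S.1
      pure (next, Function.update S.2 k S.1))
    (P := fun k S => S.1 = A ^ k * B ∧ ∀ j : Fin t, (j : ℕ) < k → S.2 j = A ^ (j : ℕ) * B)
    (s := (B, fun _ => 0)) ⟨by simp, fun _ h => absurd h (Nat.not_lt_zero _)⟩
    (fun k S hS => by
      refine ⟨?_, fun j hj => ?_⟩
      · change A * S.1 = _
        rw [hS.1, pow_succ', Matrix.mul_assoc]
      · change Function.update S.2 k S.1 j = _
        by_cases h : j = k
        · rw [h, Function.update_self, hS.1]
        · rw [Function.update_of_ne h]
          exact hS.2 j (by have := Fin.val_ne_of_ne h; omega))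
  ext r q
  exact congrFun (congrFun (h.2 q.1 q.1.2) r) q.2

lemma schedulingAlgorithm_isOutput (c₀ : ℕ) {A : Matrix (Fin n) (Fin n) ℝ}
    {B : Matrix (Fin n) (Fin m) ℝ} {t κ : ℕ} (hn : 0 < n) (hm : 0 < m) (hnt : n ≤ t) (hκ : n < κ)
    (hAB : IsControllable A B) :
    IsAlgorithmOutput A B t κ (schedulingAlgorithm c₀ A B t κ).val := by
  have : NeZero n := ⟨hn.ne'⟩
  have hVV := whitenedCtrb_mul_transpose (posDef_ctrbMatrix_mul_transpose hAB hnt)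
  have henum : ∀ q : Fin t × Fin m, q ∈ (List.finRange t).product (List.finRange m) := fun q =>
    List.mem_product.2 ⟨List.mem_finRange _, List.mem_finRange _⟩
  refine ⟨_, dualSetStar_val henum (List.ne_nil_of_mem (henum (⟨0, hn.trans_le hnt⟩, ⟨0, hm⟩)))
    hκ hVV hVV, ?_⟩
  have h : whitenedCtrb A B t = invSqrt ((ctrbProgram A B t).val * ((ctrbProgram A B t).val)ᵀ)
      * (ctrbProgram A B t).val := by
    rw [ctrbProgram_val, whitenedCtrb]
  rw [h]
  rfl

end Correctness

/-! ### Operation counts -/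

section Cost

variable {n m : ℕ} {ι : Type} [DecidableEq ι]

lemma greedyUpdate_ops_le (enum : List ι) (V U : Matrix (Fin n) ι ℝ) (S : DualState n n ι)
    (low up : ι → ℝ) :
    (greedyUpdate enum V U S low up).ops ≤ enum.length * 2 + (3 + 6 * (n * n)) := by
  refine bind_ops_le (argmaxScan_ops_le _ _ _ _) fun best => ?_
  cases best with
  | none => exact Nat.zero_le _
  | some jh =>
    have : 3 + 6 * (n * n) = 1 + (1 + (1 + (n * (n * 3) + (n * (n * 3) + 0)))) := by ring
    rw [this]
    exact bind_ops_le le_rfl fun z => bind_ops_le le_rfl fun Δ => bind_ops_le le_rfl fun c =>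
      bind_ops_le (addRankOne_ops_le _ _ _) fun _ =>
      bind_ops_le (addRankOne_ops_le _ _ _) fun _ => le_rfl

lemma quadForms_ops_le (P : Matrix (Fin n) (Fin n) ℝ) (v : Fin n → ℝ) :
    (quadForms P v).ops ≤ n * (n * 2) + (n * (n * 2) + (n * 2 + (n * 2 + 0))) := by
  refine bind_ops_le (by simpa using mulVec_ops_le P v) fun w => ?_
  refine bind_ops_le (by simpa using mulVec_ops_le P w) fun z => ?_
  refine bind_ops_le (by simpa using dot_ops_le v w) fun a => ?_
  exact bind_ops_le (by simpa using dot_ops_le v z) fun b => le_rfl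

variable [Fintype ι]

lemma dualIteration_ops_le (enum : List ι) (V U : Matrix (Fin n) ι ℝ) (δ rn rl : ℝ) (τ : ℕ)
    (S : DualState n n ι) :
    (dualIteration enum V U δ rn rl τ S).ops ≤
      16 * n ^ 3 + 14 * n ^ 2 + 4 * n + 11 +
        Fintype.card ι * (8 * n ^ 2 + 8 * n + 4) + 2 * enum.length := by
  have key : (dualIteration enum V U δ rn rl τ S).ops ≤
      1 + (1 + (1 + (1 + (1 + (1 + (n * n + (n * n + (n * n + (n * n +
      (n * (n * (n * 2) + (n * 1 + n * (n * 2))) + (n * (n * (n * 2) + (n * 1 + n * (n * 2))) +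
      (n * (n * (n * 2) + (n * 1 + n * (n * 2))) + (n * (n * (n * 2) + (n * 1 + n * (n * 2))) +
      (n + (n + (n + (n + (1 + (1 +
      (Fintype.card ι * (n * (n * 2) + (n * (n * 2) + (n * 2 + (n * 2 + 0))) + (1 + 1)) +
      (Fintype.card ι * (n * (n * 2) + (n * (n * 2) + (n * 2 + (n * 2 + 0))) + (1 + 1)) +
      (enum.length * 2 + (3 + 6 * (n * n)))))))))))))))))))))))) := by
    refine bind_ops_le le_rfl fun x => bind_ops_le le_rfl fun μ => bind_ops_le le_rfl fun μ' =>
      bind_ops_le le_rfl fun y => bind_ops_le le_rfl fun ν => bind_ops_le le_rfl fun ν' =>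
      bind_ops_le (subScalar_ops_le _ _) fun _ => bind_ops_le (subScalar_ops_le _ _) fun _ =>
      bind_ops_le (scalarSub_ops_le _ _) fun _ => bind_ops_le (scalarSub_ops_le _ _) fun _ =>
      bind_ops_le (inverse_ops_le _) fun P => bind_ops_le (inverse_ops_le _) fun P' =>
      bind_ops_le (inverse_ops_le _) fun Q => bind_ops_le (inverse_ops_le _) fun Q' =>
      bind_ops_le (trace_ops_le _) fun _ => bind_ops_le (trace_ops_le _) fun _ =>
      bind_ops_le (trace_ops_le _) fun _ => bind_ops_le (trace_ops_le _) fun _ =>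
      bind_ops_le le_rfl fun _ => bind_ops_le le_rfl fun _ =>
      bind_ops_le (tabulate_ops_le fun i => ?_) fun low =>
      bind_ops_le (tabulate_ops_le fun i => ?_) fun up =>
      greedyUpdate_ops_le enum V U S low up
    all_goals exact bind_ops_le (quadForms_ops_le _ _) fun ab => bind_ops_le le_rfl fun z => le_rfl
  refine key.trans (le_of_eq ?_)
  ring

lemma dualSetStar_ops_le (enum : List ι) (V U : Matrix (Fin n) ι ℝ) (κ : ℕ) :
    (dualSetStar enum V U κ).ops ≤
      15 + κ * (16 * n ^ 3 + 14 * n ^ 2 + 4 * n + 11 +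
        Fintype.card ι * (8 * n ^ 2 + 8 * n + 4) + 2 * enum.length) + Fintype.card ι := by
  have key : (dualSetStar enum V U κ).ops ≤
      1 + (1 + (1 + (1 + (1 + (1 + (1 + (1 + (1 + (1 + (1 + (1 + (1 + (1 +
      ((List.range κ).length * (16 * n ^ 3 + 14 * n ^ 2 + 4 * n + 11 +
        Fintype.card ι * (8 * n ^ 2 + 8 * n + 4) + 2 * enum.length) +
      (1 + Fintype.card ι * 1))))))))))))))) := by
    exact bind_ops_le le_rfl fun _ => bind_ops_le le_rfl fun _ => bind_ops_le le_rfl fun _ =>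
      bind_ops_le le_rfl fun _ => bind_ops_le le_rfl fun _ => bind_ops_le le_rfl fun _ =>
      bind_ops_le le_rfl fun _ => bind_ops_le le_rfl fun _ => bind_ops_le le_rfl fun _ =>
      bind_ops_le le_rfl fun _ => bind_ops_le le_rfl fun _ => bind_ops_le le_rfl fun _ =>
      bind_ops_le le_rfl fun _ => bind_ops_le le_rfl fun _ =>
      bind_ops_le (loop_ops_le (fun τ S => dualIteration_ops_le enum V U _ _ _ τ S) _) fun S =>
      bind_ops_le le_rfl fun f => tabulate_ops_le fun i => le_rfl
  refine key.trans (le_of_eq ?_)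
  rw [List.length_range]
  ring

lemma ctrbProgram_ops_le (A : Matrix (Fin n) (Fin n) ℝ) (B : Matrix (Fin n) (Fin m) ℝ) (t : ℕ) :
    (ctrbProgram A B t).ops ≤ t * (2 * n ^ 2 * m) := by
  have key : (ctrbProgram A B t).ops ≤
      (List.finRange t).length * (n * (m * (n * 2)) + 0) + 0 := by
    refine bind_ops_le (loop_ops_le (fun k S => ?_) _) fun _ => le_rfl
    exact bind_ops_le (by simpa using matMul_ops_le A S.1) fun _ => le_rfl
  refine key.trans (le_of_eq ?_)
  rw [List.length_finRange]
  ring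

lemma schedulingAlgorithm_ops_le (c₀ : ℕ) (A : Matrix (Fin n) (Fin n) ℝ)
    (B : Matrix (Fin n) (Fin m) ℝ) (t κ : ℕ) :
    (schedulingAlgorithm c₀ A B t κ).ops ≤
      6 * (t * m * n ^ 2) + c₀ * n ^ 3 + 19 + 3 * (t * m) +
        κ * (16 * n ^ 3 + 14 * n ^ 2 + 4 * n + 11 + t * m * (8 * n ^ 2 + 8 * n + 6)) := by
  have key : (schedulingAlgorithm c₀ A B t κ).ops ≤
      t * (2 * n ^ 2 * m) + (n * (n * (t * m * 2)) + (c₀ * n ^ 3 + (n * (t * m * (n * 2)) +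
      ((15 + κ * (16 * n ^ 3 + 14 * n ^ 2 + 4 * n + 11 + t * m * (8 * n ^ 2 + 8 * n + 4) +
        2 * ((List.finRange t).product (List.finRange m)).length) + t * m) +
      (1 + (1 + (1 + (1 + m * (t * (1 + 1)))))))))) := by
    refine bind_ops_le (ctrbProgram_ops_le A B t) fun C => ?_
    refine bind_ops_le (by simpa using matMul_ops_le C Cᵀ) fun W => ?_
    refine bind_ops_le le_rfl fun R => ?_
    refine bind_ops_le (by simpa using matMul_ops_le R C) fun V => ?_
    refine bind_ops_le
      (by simpa using dualSetStar_ops_le ((List.finRange t).product (List.finRange m)) V V κ)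
      fun c => ?_
    refine bind_ops_le le_rfl fun _ => bind_ops_le le_rfl fun _ => bind_ops_le le_rfl fun _ =>
      bind_ops_le le_rfl fun e => ?_
    have h : ∀ i : Fin m, (tabulate fun k : Fin t => do
        let z ← div (c (k.rev, i)) e
        Counted.sqrt z).ops ≤ t * (1 + 1) := fun i => by
      simpa using tabulate_ops_le (f := fun k : Fin t => do
        let z ← div (c (k.rev, i)) e
        Counted.sqrt z) (c := 1 + 1) fun k => le_rfl
    simpa using tabulate_ops_le h
  refine key.trans (le_of_eq ?_)
  have hlen : ((List.finRange t).product (List.finRange m)).length = t * m :=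
    (List.length_product _ _).trans (by simp)
  rw [hlen]
  ring

lemma schedulingAlgorithm_ops_le_mul (c₀ : ℕ) (A : Matrix (Fin n) (Fin n) ℝ)
    (B : Matrix (Fin n) (Fin m) ℝ) {t κ : ℕ} (hn : 0 < n) (hm : 0 < m) (hnt : n ≤ t)
    (hκ : 0 < κ) :
    (schedulingAlgorithm c₀ A B t κ).ops ≤ (c₀ + 95) * (κ * (t * m * n ^ 2)) := by
  refine (schedulingAlgorithm_ops_le c₀ A B t κ).trans ?_
  have htm : n ≤ t * m := hnt.trans (Nat.le_mul_of_pos_right t hm)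
  have hn1 : n ≤ n ^ 2 := by nlinarith
  have hn2 : 1 ≤ n ^ 2 := by nlinarith
  -- Every term of the count is absorbed by `κ N n²`, where `N = t m ≥ n` is the number of columns.
  generalize t * m = N at htm ⊢
  have h1 : n ^ 3 ≤ N * n ^ 2 := by rw [pow_succ']; exact Nat.mul_le_mul_right _ htm
  have h2 : N * n ≤ N * n ^ 2 := Nat.mul_le_mul_left _ hn1
  have h3 : N ≤ N * n ^ 2 := Nat.le_mul_of_pos_right _ hn2
  have h4 : n ^ 2 ≤ N * n ^ 2 := Nat.le_mul_of_pos_left _ (hn.trans_le htm)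
  have h5 : 16 * n ^ 3 + 14 * n ^ 2 + 4 * n + 11 + N * (8 * n ^ 2 + 8 * n + 6)
      ≤ 67 * (N * n ^ 2) := by nlinarith
  have h6 : N * n ^ 2 ≤ κ * (N * n ^ 2) := Nat.le_mul_of_pos_left _ hκ
  have h7 : c₀ * n ^ 3 ≤ c₀ * (κ * (N * n ^ 2)) := Nat.mul_le_mul_left _ (h1.trans h6)
  have h8 := Nat.mul_le_mul_left κ h5
  have h9 : 1 ≤ N * n ^ 2 := hn2.trans h4
  nlinarith

end Cost

lemma IsControllable.pos {n m : ℕ} {A : Matrix (Fin n) (Fin n) ℝ} {B : Matrix (Fin n) (Fin m) ℝ}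
    (hn : 0 < n) (hAB : IsControllable A B) : 0 < m := by
  have h := rank_le_card_width (ctrbMatrix A B n)
  rw [hAB] at h
  rcases Nat.eq_zero_or_pos m with rfl | hm
  · simp at h; omega
  · exact hm

end ActuatorScheduling

theorem mainTheorem1 (c₀ : ℕ) :
    ∃ K : ℝ, ∀ (n m t κ : ℕ) (d : ℝ) (A : Matrix (Fin n) (Fin n) ℝ) (B : Matrix (Fin n) (Fin m) ℝ),
      0 < n → n ≤ t → 1 < d → (κ : ℝ) = d * t →
      ActuatorScheduling.IsControllable A B →
        (∀ s : Fin m → Fin t → ℝ, ActuatorScheduling.IsAlgorithmOutput A B t κ s →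
          ActuatorScheduling.IsApproximation A B t
            (2 / (√(d * t / n) + √(n / (d * t)))) d s) ∧
        ActuatorScheduling.IsAlgorithmOutput A B t κ
          (ActuatorScheduling.schedulingAlgorithm c₀ A B t κ).val ∧
        ((ActuatorScheduling.schedulingAlgorithm c₀ A B t κ).ops : ℝ) ≤
          K * (d * m * ((t : ℝ) * n) ^ 2) := by
  refine ⟨c₀ + 95, fun n m t κ d A B hn hnt hd hκ hAB => ?_⟩
  have hnt' : (n : ℝ) ≤ t := by exact_mod_cast hnt
  have hn0 : (0 : ℝ) < n := by exact_mod_cast hn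
  have hnκ : n < κ := by
    have : (n : ℝ) < κ := by rw [hκ]; nlinarith
    exact_mod_cast this
  have hm := hAB.pos hn
  refine ⟨fun s hs => hs.isApproximation hn hnt hd hκ hAB,
    ActuatorScheduling.schedulingAlgorithm_isOutput c₀ hn hm hnt hnκ hAB, ?_⟩
  have h := ActuatorScheduling.schedulingAlgorithm_ops_le_mul c₀ A B hn hm hnt (hn.trans hnκ)
  calc ((ActuatorScheduling.schedulingAlgorithm c₀ A B t κ).ops : ℝ)
      ≤ ((c₀ + 95) * (κ * (t * m * n ^ 2)) : ℕ) := Nat.cast_le.2 h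
    _ = (c₀ + 95) * (d * m * ((t : ℝ) * n) ^ 2) := by
      push_cast
      rw [hκ]
      ring
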